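/- Let $(\Omega,\mathcal E,P)$ be a probability space, $\mathcal F\subseteq\mathcal E$ a sub-$\sigma$-algebra and $1<p<\infty$. Write $L^0(\mathcal F)$ (resp. $\bar L^0(\mathcal F)$) for the set of $P$-a.s. equivalence classes of real (resp. extended real) valued $\mathcal F$-measurable random variables, ordered by a.s. inequality, and $L^0_{++}(\mathcal F)=\{\xi\in L^0(\mathcal F):\xi>0\text{ a.s.}\}$. Let $L^p_{\mathcal F}(\mathcal E)$ be the $L^0(\mathcal F)$-module of all $x\in L^0(\mathcal E)$ with $E[|x|^p\mid\mathcal F]<\infty$ a.s., put $|||x|||_p=E[|x|^p\mid\mathcal F]^{1/p}$, and let $E[x\mid\mathcal F]=E[x^+\mid\mathcal F]-E[x^-\mid\mathcal F]$ be the generalized conditional expectation. The $(\varepsilon,\lambda)$-topology on $L^p_{\mathcal F}(\mathcal E)$ has the local base $\{x:P(|||x|||_p<\varepsilon)>1-\lambda\}$ at $0$, with real $\varepsilon>0$ and $0<\lambda<1$; on $L^0(\mathcal F)$ it is defined in the same way from $|\cdot|$ (convergence in probability). The locally $L^0$-convex topology $\mathcal T_c$ on $L^p_{\mathcal F}(\mathcal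 E)$ has the local base $\{x:|||x|||_p\le\varepsilon\}$ at $0$, with $\varepsilon\in L^0_{++}(\mathcal F)$. A conditional convex risk measure is a map $\rho:L^p_{\mathcal F}(\mathcal E)\to\bar L^0(\mathcal F)$ such that: * $\rho$ is proper: $\rho(x)>-\infty$ a.s. for every $x$, and $\rho(x)<+\infty$ a.s. for some $x$; * $\{x:\rho(x)\le s\}$ is $\mathcal T_c$-closed for every $s\in L^0(\mathcal F)$; * $\rho(\xi x+(1-\xi)y)\le\xi\rho(x)+(1-\xi)\rho(y)$ for all $x,y$ and all $\xi\in L^0(\mathcal F)$ with $0\le\xi\le1$ (where $0\cdot(+\infty)=0$); * $\rho(x)\le\rho(y)$ whenever $x\ge y$; * $\rho(x+c)=\rho(x)-c$ for all $x$ and all $c\in L^0(\mathcal F)$. Let $M$ be an $L^0(\mathcal F)$-submodule of $L^p_{\mathcal F}(\mathcal E)$ that is closed in the $(\varepsilon,\lambda)$-topology, $\pi:M\to L^0(\mathcal F)$ an $L^0(\mathcal F)$-module homomorphism that is continuous for the $(\varepsilon,\lambda)$-topologies, $w\in L^0(\mathcal F)$ and $r\in L^0_{++}(\mathcal F)$.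 Assume that $$G=\{x\in M:\pi(x)=1,\ E[x\mid\mathcal F]=w,\ |||x|||_p\le r\}$$ is nonempty. Then every conditional convex risk measure $\rho$ on $L^p_{\mathcal F}(\mathcal E)$ attains its minimum over $G$: there is $x^*\in G$ with $\rho(x^*)\le\rho(x)$ a.s. for all $x\in G$. -/

import Mathlib

open MeasureTheory Topology
open scoped ENNReal NNReal

noncomputable section

namespace CondRisk

variable {Ω : Type*}

/-- The ring `L⁰(ℰ)` of classes of real random variables, with Mathlib's operations. -/
instance instCommRingAEEqFun {mΩ : MeasurableSpace Ω} {P : Measure Ω} :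
    CommRing (Ω →ₘ[P] ℝ) :=
  { (inferInstance : AddCommGroup (Ω →ₘ[P] ℝ)), (inferInstance : CommMonoid (Ω →ₘ[P] ℝ)) with
    left_distrib := fun a b c => AEEqFun.toGerm_injective <| by
      simp only [AEEqFun.mul_toGerm, AEEqFun.add_toGerm, mul_add]
    right_distrib := fun a b c => AEEqFun.toGerm_injective <| by
      simp only [AEEqFun.mul_toGerm, AEEqFun.add_toGerm, add_mul]
    zero_mul := fun a => AEEqFun.toGerm_injective <| by
      simp only [AEEqFun.mul_toGerm, AEEqFun.zero_toGerm, zero_mul]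
    mul_zero := fun a => AEEqFun.toGerm_injective <| by
      simp only [AEEqFun.mul_toGerm, AEEqFun.zero_toGerm, mul_zero] }

/-- `L⁰(ℱ)`: classes (modulo `P`-a.s. equality) of real random variables having an `m`-measurable
representative (`m` is the sub-σ-algebra `ℱ`), as a subring of the ring `L⁰(ℰ)` of classes of
`mΩ`-measurable ones. -/
def L0 (m : MeasurableSpace Ω) {mΩ : MeasurableSpace Ω} (P : Measure Ω) : Subring (Ω →ₘ[P] ℝ) where
  carrier := {f | AEStronglyMeasurable[m] f P}
  mul_mem' {a b} ha hb := (ha.mul hb).congr (AEEqFun.coeFn_mul a b).symm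
  one_mem' := (aestronglyMeasurable_const (b := (1 : ℝ))).congr AEEqFun.coeFn_one.symm
  add_mem' {a b} ha hb := (ha.add hb).congr (AEEqFun.coeFn_add a b).symm
  zero_mem' := (aestronglyMeasurable_const (b := (0 : ℝ))).congr AEEqFun.coeFn_zero.symm
  neg_mem' {a} ha := ha.neg.congr (AEEqFun.coeFn_neg a).symm

/-- `L̄⁰(ℱ)`: classes of extended real random variables having an `m`-measurable representative;
it carries the order of a.s. inequality inherited from `Ω →ₘ[P] EReal`. -/
abbrev L0bar (m : MeasurableSpace Ω) {mΩ : MeasurableSpace Ω} (P : Measure Ω) : Type _ :=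
  {f : Ω →ₘ[P] EReal // AEStronglyMeasurable[m] f P}

/-- Elements of `L⁰₊₊(ℱ)`: a.s. strictly positive. -/
def IsPos {m mΩ : MeasurableSpace Ω} {P : Measure Ω} (r : L0 m P) : Prop :=
  ∀ᵐ ω ∂P, 0 < (r : Ω →ₘ[P] ℝ) ω

/-- `E[|x|^p | ℱ]`, the conditional expectation of a nonnegative random variable, with values in
`[0, ∞]`. -/
def condPow (m : MeasurableSpace Ω) {mΩ : MeasurableSpace Ω} (P : Measure Ω) (p : ℝ≥0) (x : Ω →ₘ[P] ℝ) : Ω → ℝ≥0∞ :=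
  condLExp m P (fun ω => ‖x ω‖ₑ ^ (p : ℝ))

theorem condLExp_mul_left {m mΩ : MeasurableSpace Ω} {P : Measure Ω} {X Y : Ω → ℝ≥0∞}
    (hY : Measurable[m] Y) (hX : AEMeasurable X P) :
    condLExp m P (fun ω => Y ω * X ω) =ᵐ[P] fun ω => Y ω * condLExp m P X ω := by
  by_cases hm : m ≤ mΩ
  swap
  · simp [condLExp_of_not_le hm, Filter.EventuallyEq]
  by_cases hσ : SigmaFinite (P.trim hm)
  swap
  · simp [condLExp_of_not_sigmaFinite hm hσ, Filter.EventuallyEq]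
  symm
  refine ae_eq_condLExp hm P _ (hY.mul (measurable_condLExp m P X)) ?_
  intro s hs
  have key : ((P.withDensity X).trim hm) = (P.trim hm).withDensity (condLExp m P X) := by
    refine @Measure.ext _ m _ _ fun t ht => ?_
    rw [trim_measurableSet_eq hm ht, withDensity_apply _ (hm t ht), withDensity_apply _ ht,
      setLIntegral_condLExp_trim hm P X ht]
  have h1 : ∫⁻ ω in s, Y ω * X ω ∂P = ∫⁻ ω in s, Y ω ∂(P.withDensity X) := by
    rw [setLIntegral_withDensity_eq_lintegral_mul₀ hX (hY.mono hm le_rfl).aemeasurable (hm s hs)]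
    exact lintegral_congr fun ω => by simp [mul_comm]
  rw [h1, ← setLIntegral_trim hm hY hs, key,
    setLIntegral_withDensity_eq_setLIntegral_mul _ (measurable_condLExp m P X) hY hs,
    setLIntegral_trim hm ((measurable_condLExp m P X).mul hY) hs]
  exact lintegral_congr fun ω => by simp [mul_comm]

theorem measurable_enorm_rpow {mΩ : MeasurableSpace Ω} {P : Measure Ω} (p : ℝ≥0) (x : Ω →ₘ[P] ℝ) :
    Measurable (fun ω => ‖x ω‖ₑ ^ (p : ℝ)) :=
  x.measurable.enorm.pow_const _

/-- `L^p_ℱ(ℰ)`: the classes `x ∈ L⁰(ℰ)` with `E[|x|^p | ℱ] < ∞` a.s., a module over `L⁰(ℱ)`. -/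
def condLp (m : MeasurableSpace Ω) {mΩ : MeasurableSpace Ω} (P : Measure Ω) (p : ℝ≥0) :
    Submodule (L0 m P) (Ω →ₘ[P] ℝ) where
  carrier := {x | ∀ᵐ ω ∂P, condPow m P p x ω < ∞}
  zero_mem' := by
    have h : condPow m P p (0 : Ω →ₘ[P] ℝ) ≤ᵐ[P] condLExp m P (fun _ => (0 : ℝ≥0∞) ^ (p : ℝ)) := by
      refine condLExp_mono ?_
      filter_upwards [AEEqFun.coeFn_zero (α := Ω) (μ := P) (β := ℝ)] with ω hω
      simp [hω]
    by_cases hm : m ≤ mΩ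
    swap
    · simp [condPow, condLExp_of_not_le hm]
    by_cases hσ : SigmaFinite (P.trim hm)
    swap
    · simp [condPow, condLExp_of_not_sigmaFinite hm hσ]
    filter_upwards [h] with ω hω
    rw [condLExp_const hm] at hω
    exact hω.trans_lt (ENNReal.rpow_lt_top_of_nonneg p.coe_nonneg (by simp))
  add_mem' {x y} hx hy := by
    have h : condPow m P p (x + y) ≤ᵐ[P] condLExp m P
        ((2 : ℝ≥0∞) ^ (p : ℝ) • ((fun ω => ‖x ω‖ₑ ^ (p : ℝ)) + fun ω => ‖y ω‖ₑ ^ (p : ℝ))) := by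
      refine condLExp_mono ?_
      filter_upwards [AEEqFun.coeFn_add x y] with ω hω
      simp only [hω, Pi.add_apply, Pi.smul_apply, smul_eq_mul]
      have h2 : ‖x ω + y ω‖ₑ ≤ 2 * max ‖x ω‖ₑ ‖y ω‖ₑ := by
        rw [two_mul]
        exact (enorm_add_le _ _).trans (add_le_add (le_max_left _ _) (le_max_right _ _))
      refine (ENNReal.rpow_le_rpow h2 p.coe_nonneg).trans ?_
      rw [ENNReal.mul_rpow_of_nonneg _ _ p.coe_nonneg]
      refine mul_le_mul_right ?_ _
      rcases le_total ‖x ω‖ₑ ‖y ω‖ₑ with h | h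
      · rw [max_eq_right h]; exact le_add_self
      · rw [max_eq_left h]; exact le_self_add
    have h2 : (2 : ℝ≥0∞) ^ (p : ℝ) < ∞ := ENNReal.rpow_lt_top_of_nonneg p.coe_nonneg (by simp)
    change ∀ᵐ ω ∂P, condPow m P p (x + y) ω < ∞
    filter_upwards [h, condLExp_smul' (mΩ := m) (P := P)
      ((fun ω => ‖x ω‖ₑ ^ (p : ℝ)) + fun ω => ‖y ω‖ₑ ^ (p : ℝ)) h2.ne,
      condLExp_add_left (mΩ := m) (P := P) (fun ω => ‖y ω‖ₑ ^ (p : ℝ))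
        (measurable_enorm_rpow p x).aemeasurable, hx, hy] with ω h h' h'' hx hy
    refine h.trans_lt ?_
    rw [h', Pi.smul_apply, h'', smul_eq_mul]
    exact ENNReal.mul_lt_top h2 (ENNReal.add_lt_top.2 ⟨hx, hy⟩)
  smul_mem' c x hx := by
    obtain ⟨g, hg, hcg⟩ := c.2
    have hg' : Measurable[m] (fun ω => ‖g ω‖ₑ ^ (p : ℝ)) := by
      have h1 : Measurable[m] g := hg.measurable
      exact (measurable_enorm.comp h1).pow_const _
    have h : condPow m P p (c • x) =ᵐ[P]
        condLExp m P (fun ω => ‖g ω‖ₑ ^ (p : ℝ) * ‖x ω‖ₑ ^ (p : ℝ)) := by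
      refine condLExp_congr_ae ?_
      filter_upwards [AEEqFun.coeFn_mul (c : Ω →ₘ[P] ℝ) x, hcg] with ω hω hc
      have : (c • x : Ω →ₘ[P] ℝ) ω = g ω * x ω := by
        rw [← hc]; exact hω
      rw [this, enorm_mul, ENNReal.mul_rpow_of_nonneg _ _ p.coe_nonneg]
    change ∀ᵐ ω ∂P, condPow m P p (c • x) ω < ∞
    filter_upwards [h, condLExp_mul_left hg' (measurable_enorm_rpow p x).aemeasurable, hx]
      with ω h h' hx
    rw [h, h']
    exact ENNReal.mul_lt_top (ENNReal.rpow_lt_top_of_nonneg p.coe_nonneg (by simp)) hx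

theorem L0_le_condLp {m mΩ : MeasurableSpace Ω} {P : Measure Ω} {p : ℝ≥0} (c : L0 m P) :
    (c : Ω →ₘ[P] ℝ) ∈ condLp m P p := by
  have h1 : (1 : Ω →ₘ[P] ℝ) ∈ condLp m P p := by
    have h : condPow m P p (1 : Ω →ₘ[P] ℝ) =ᵐ[P] condLExp m P (fun _ => (1 : ℝ≥0∞)) := by
      refine condLExp_congr_ae ?_
      filter_upwards [AEEqFun.coeFn_one (α := Ω) (μ := P) (β := ℝ)] with ω hω
      simp [hω]
    by_cases hm : m ≤ mΩ
    swap
    · simp [condLp, condPow, condLExp_of_not_le hm]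
    by_cases hσ : SigmaFinite (P.trim hm)
    swap
    · simp [condLp, condPow, condLExp_of_not_sigmaFinite hm hσ]
    change ∀ᵐ ω ∂P, condPow m P p 1 ω < ∞
    filter_upwards [h] with ω hω
    rw [hω, condLExp_const hm]
    simp
  have := (condLp m P p).smul_mem c h1
  rwa [show c • (1 : Ω →ₘ[P] ℝ) = c from mul_one (c : Ω →ₘ[P] ℝ)] at this

/-- The inclusion `L⁰(ℱ) ⊆ L^p_ℱ(ℰ)`. -/
def ofL0 {m mΩ : MeasurableSpace Ω} {P : Measure Ω} (p : ℝ≥0) (c : L0 m P) : condLp m P p :=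
  ⟨c, L0_le_condLp c⟩

/-- The class in `L⁰(ℱ)` of an `m`-measurable function of the form `ω ↦ g ω`. -/
def mkL0 {m mΩ : MeasurableSpace Ω} (P : Measure Ω) (hm : m ≤ mΩ) (g : Ω → ℝ) (hg : Measurable[m] g) :
    L0 m P :=
  ⟨AEEqFun.mk g (hg.mono hm le_rfl).aestronglyMeasurable,
    ⟨g, hg.stronglyMeasurable, AEEqFun.coeFn_mk _ _⟩⟩

/-- The `L⁰`-norm `|||x|||_p = E[|x|^p | ℱ]^{1/p}` on `L^p_ℱ(ℰ)`. -/
def condNorm {m mΩ : MeasurableSpace Ω} (hm : m ≤ mΩ) {P : Measure Ω} {p : ℝ≥0}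
    (x : condLp m P p) : L0 m P :=
  mkL0 P hm (fun ω => (condPow m P p x ω).toReal ^ (1 / (p : ℝ)))
    ((measurable_condLExp m P _).ennreal_toReal.pow_const _)

/-- The generalized conditional expectation `E[x | ℱ] = E[x⁺ | ℱ] - E[x⁻ | ℱ]`. Both terms are
a.s. finite for `x ∈ L^p_ℱ(ℰ)` with `p ≥ 1`. -/
def condE {m mΩ : MeasurableSpace Ω} (hm : m ≤ mΩ) {P : Measure Ω} (x : Ω →ₘ[P] ℝ) : L0 m P :=
  mkL0 P hm
    (fun ω => (condLExp m P (fun ω => ENNReal.ofReal (x ω)) ω).toReal -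
      (condLExp m P (fun ω => ENNReal.ofReal (-x ω)) ω).toReal)
    ((measurable_condLExp m P _).ennreal_toReal.sub (measurable_condLExp m P _).ennreal_toReal)

/-- The `(ε, λ)`-topology of an `L⁰`-norm `nrm` on `E`: the translation invariant topology with
local base `{y | P {‖y‖ < ε} > 1 - λ}`, `ε > 0`, `0 < λ < 1`, at the origin. -/
@[reducible] def epsTopology {m mΩ : MeasurableSpace Ω} {P : Measure Ω} {E : Type*} [AddCommGroup E]
    (nrm : E → L0 m P) : TopologicalSpace E where
  IsOpen U := ∀ x ∈ U, ∃ ε l : ℝ, 0 < ε ∧ 0 < l ∧ l < 1 ∧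
    ∀ y, 1 - ENNReal.ofReal l < P {ω | (nrm (y - x) : Ω →ₘ[P] ℝ) ω < ε} → y ∈ U
  isOpen_univ := fun _ _ => ⟨1, 1 / 2, by norm_num, by norm_num, by norm_num, fun _ _ => trivial⟩
  isOpen_inter := by
    rintro U V hU hV x ⟨hxU, hxV⟩
    obtain ⟨ε, l, hε, hl, hl1, h⟩ := hU x hxU
    obtain ⟨ε', l', hε', hl', hl1', h'⟩ := hV x hxV
    refine ⟨min ε ε', min l l', lt_min hε hε', lt_min hl hl', min_lt_of_left_lt hl1,
      fun y hy => ⟨h y ?_, h' y ?_⟩⟩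
    · refine (tsub_le_tsub_left (ENNReal.ofReal_le_ofReal (min_le_left l l')) 1).trans_lt
        (hy.trans_le (measure_mono fun ω hω => by
          simp only [Set.mem_ofPred_eq, lt_min_iff] at hω ⊢; exact hω.1))
    · refine (tsub_le_tsub_left (ENNReal.ofReal_le_ofReal (min_le_right l l')) 1).trans_lt
        (hy.trans_le (measure_mono fun ω hω => by
          simp only [Set.mem_ofPred_eq, lt_min_iff] at hω ⊢; exact hω.2))
  isOpen_sUnion := by
    rintro S hS x ⟨U, hU, hx⟩
    obtain ⟨ε, l, hε, hl, hl1, h⟩ := hS U hU x hx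
    exact ⟨ε, l, hε, hl, hl1, fun y hy => ⟨U, hU, h y hy⟩⟩

theorem inf_mem_L0 {m mΩ : MeasurableSpace Ω} {P : Measure Ω} (a b : L0 m P) :
    (a : Ω →ₘ[P] ℝ) ⊓ b ∈ L0 m P := by
  obtain ⟨f, hf, haf⟩ := a.2
  obtain ⟨g, hg, hbg⟩ := b.2
  refine ⟨fun ω => f ω ⊓ g ω, continuous_inf.comp_stronglyMeasurable (hf.prodMk hg), ?_⟩
  filter_upwards [haf, hbg, AEEqFun.coeFn_inf (a : Ω →ₘ[P] ℝ) b] with ω h1 h2 h3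
  rw [h3, h1, h2]

/-- The locally `L⁰`-convex topology of an `L⁰`-norm `nrm` on `E`: the translation invariant
topology with local base `{y | ‖y‖ ≤ ε}`, `ε ∈ L⁰₊₊(ℱ)`, at the origin. -/
@[reducible] def locTopology {m mΩ : MeasurableSpace Ω} {P : Measure Ω} {E : Type*} [AddCommGroup E]
    (nrm : E → L0 m P) : TopologicalSpace E where
  IsOpen U := ∀ x ∈ U, ∃ ε : L0 m P, IsPos ε ∧
    ∀ y, (nrm (y - x) : Ω →ₘ[P] ℝ) ≤ ε → y ∈ U
  isOpen_univ := fun _ _ => ⟨1, by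
    unfold IsPos
    filter_upwards [AEEqFun.coeFn_one (α := Ω) (μ := P) (β := ℝ)] with ω hω
    rw [show ((1 : L0 m P) : Ω →ₘ[P] ℝ) = 1 from rfl, hω]
    exact one_pos, fun _ _ => trivial⟩
  isOpen_inter := by
    rintro U V hU hV x ⟨hxU, hxV⟩
    obtain ⟨ε, hε, h⟩ := hU x hxU
    obtain ⟨ε', hε', h'⟩ := hV x hxV
    refine ⟨⟨(ε : Ω →ₘ[P] ℝ) ⊓ ε', inf_mem_L0 ε ε'⟩, ?_, fun y hy => ⟨h y ?_, h' y ?_⟩⟩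
    · filter_upwards [hε, hε', AEEqFun.coeFn_inf (ε : Ω →ₘ[P] ℝ) ε'] with ω h1 h2 h3
      exact h3 ▸ lt_min h1 h2
    · exact hy.trans (AEEqFun.inf_le_left _ _)
    · exact hy.trans (AEEqFun.inf_le_right _ _)
  isOpen_sUnion := by
    rintro S hS x ⟨U, hU, hx⟩
    obtain ⟨ε, hε, h⟩ := hS U hU x hx
    exact ⟨ε, hε, fun y hy => ⟨U, hU, h y hy⟩⟩

/-- The absolute value on `L⁰(ℱ)`, which is its `L⁰`-norm. -/
def absL0 {m mΩ : MeasurableSpace Ω} {P : Measure Ω} (c : L0 m P) : L0 m P :=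
  ⟨|(c : Ω →ₘ[P] ℝ)|, (continuous_abs.comp_aestronglyMeasurable c.2).congr
    (AEEqFun.coeFn_abs _).symm⟩

/-- Conditional convex risk measures on `L^p_ℱ(ℰ)`: proper, lower semicontinuous for the locally
`L⁰`-convex topology, `L⁰`-convex, antitone and cash invariant. Relations in `L̄⁰(ℱ)` are a.s.
pointwise ones. Since a proper function never takes the value `-∞`, no sum below involves
`(+∞) + (-∞)`; and `0 * (+∞) = 0` in `EReal`. -/
structure IsCondConvexRiskMeasure {m mΩ : MeasurableSpace Ω} (hm : m ≤ mΩ) {P : Measure Ω} {p : ℝ≥0}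
    (ρ : condLp m P p → L0bar m P) : Prop where
  ne_bot : ∀ x, ∀ᵐ ω ∂P, ⊥ < (ρ x).1 ω
  exists_ne_top : ∃ x, ∀ᵐ ω ∂P, (ρ x).1 ω < ⊤
  lsc : ∀ r : L0 m P, IsClosed[locTopology (condNorm (p := p) hm)]
    {x | ∀ᵐ ω ∂P, (ρ x).1 ω ≤ (((r : Ω →ₘ[P] ℝ) ω : ℝ) : EReal)}
  convex : ∀ (x y : condLp m P p) (ξ : L0 m P),
    (0 : Ω →ₘ[P] ℝ) ≤ ξ → (ξ : Ω →ₘ[P] ℝ) ≤ 1 →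
    ∀ᵐ ω ∂P, (ρ (ξ • x + (1 - ξ) • y)).1 ω ≤
      (((ξ : Ω →ₘ[P] ℝ) ω : ℝ) : EReal) * (ρ x).1 ω +
        ((1 - (ξ : Ω →ₘ[P] ℝ) ω : ℝ) : EReal) * (ρ y).1 ω
  antitone : ∀ x y : condLp m P p, (y : Ω →ₘ[P] ℝ) ≤ x → ρ x ≤ ρ y
  cash : ∀ (x : condLp m P p) (c : L0 m P),
    ∀ᵐ ω ∂P, (ρ (x + ofL0 p c)).1 ω = (ρ x).1 ω - (((c : Ω →ₘ[P] ℝ) ω : ℝ) : EReal)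

/-- `G = {x ∈ M : π(x) = 1, E[x | ℱ] = w, |||x|||_p ≤ r}`. -/
def feasibleSet {m mΩ : MeasurableSpace Ω} (hm : m ≤ mΩ) {P : Measure Ω} {p : ℝ≥0}
    (M : Submodule (L0 m P) (condLp m P p)) (π : M →ₗ[L0 m P] L0 m P) (w r : L0 m P) : Set M :=
  {x | π x = 1 ∧ condE hm (x : Ω →ₘ[P] ℝ) = w ∧
    (condNorm hm (x : condLp m P p) : Ω →ₘ[P] ℝ) ≤ r}

end CondRisk

end

noncomputable section

open Filter

/-! The feasible set is `L⁰`-convex, `L⁰`-bounded by `r`, and closed under almost sure convergence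
of the `L⁰`-norms (`CondTendsto`). These three properties replace compactness.

Division by `r` sends an `L⁰`-bounded set into the unit ball of the ordinary space `L^p(P)`, because
`E[|x/r|^p] = E[r^{-p} E[|x|^p | ℱ]] ≤ 1`. There, for `1 < p < ∞`, uniform convexity makes almost
norm-minimal elements of a decreasing sequence of bounded convex sets a Cauchy sequence
(`Lp_exists_tendsto_of_antitone`). Undoing the scaling and passing to an a.s. convergent
subsequence, one obtains a common point of any decreasing sequence of nonempty sets with the three
properties (`exists_forall_mem_of_antitone`).

For `ρ`, convexity with indicator weights gives locality: values may be pasted along sets of `ℱ`.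
Locality has two uses. It makes the sublevel sets of `ρ` sequentially closed, since a convergent
sequence can be concatenated along a random index so as to enter a ball of random radius
(`isCondSeqClosed_le_coe`). It also makes the values of `ρ` on an `L⁰`-convex set directed downwards
(`exists_le_le`). One then maximizes `E[φ(ρ(x))]` for a bounded strictly decreasing `φ`. The
sublevel sets along a maximizing sequence have a common point in the feasible set, and directedness
turns its optimality in expectation into a.s. minimality (`exists_isMinOn`). -/

/-! ### Uniform convexity and nested convex sets in `L^p`. -/

theorem continuous_abs_rpow {p : ℝ} (hp : 0 ≤ p) : Continuous fun x : ℝ => |x| ^ p :=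
  continuous_abs.rpow_const fun _ => Or.inr hp

/-- If `|x| ≠ |y|`, strictness comes from `t ↦ t ^ p` on `[0, ∞)`. Otherwise `y = -x ≠ 0`, and the
triangle inequality is already strict. -/
theorem strictConvexOn_abs_rpow {p : ℝ} (hp : 1 < p) :
    StrictConvexOn ℝ Set.univ fun x : ℝ => |x| ^ p := by
  refine ⟨convex_univ, fun x _ y _ hxy a b ha hb hab => ?_⟩
  simp only [smul_eq_mul]
  have hp0 : 0 < p := by linarith
  have h1 : |a * x + b * y| ≤ a * |x| + b * |y| := by
    simpa [abs_mul, abs_of_pos ha, abs_of_pos hb] using abs_add_le (a * x) (b * y)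
  by_cases h : |x| = |y|
  · have hy : y = -x := by
      rcases abs_eq_abs.1 h with h | h
      · exact absurd h hxy
      · rw [h, neg_neg]
    subst hy
    have hx : x ≠ 0 := by rintro rfl; simp at hxy
    have h2 : |a * x + b * -x| < |x| := by
      rw [show a * x + b * -x = (a - b) * x by ring, abs_mul]
      have : |a - b| < 1 := by rw [abs_lt]; constructor <;> linarith
      have := abs_pos.2 hx
      nlinarith
    refine (Real.rpow_lt_rpow (abs_nonneg _) h2 hp0).trans_eq ?_
    rw [abs_neg, ← add_mul, hab, one_mul]
  · refine (Real.rpow_le_rpow (abs_nonneg _) h1 hp0.le).trans_lt ?_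
    simpa using (strictConvexOn_rpow hp).2 (abs_nonneg x) (abs_nonneg y) h ha hb hab

/-- A homogeneous form of the uniform convexity of `|·| ^ p`. -/
theorem exists_abs_sub_rpow_le {p : ℝ} (hp : 1 < p) {ε : ℝ} (hε : 0 < ε) :
    ∃ C : ℝ, 0 ≤ C ∧ ∀ a b : ℝ, |a - b| ^ p ≤
      C * ((|a| ^ p + |b| ^ p) / 2 - |(a + b) / 2| ^ p) + ε * (|a| ^ p + |b| ^ p) := by
  have hp0 : 0 < p := by linarith
  have hc : Continuous fun x : ℝ => |x| ^ p := continuous_abs_rpow hp0.le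
  set D : ℝ × ℝ → ℝ := fun z => (|z.1| ^ p + |z.2| ^ p) / 2 - |(z.1 + z.2) / 2| ^ p with hD
  have hDc : Continuous D := by
    have h1 := hc.comp (continuous_fst (X := ℝ) (Y := ℝ))
    have h2 := hc.comp (continuous_snd (X := ℝ) (Y := ℝ))
    have h3 := hc.comp (((continuous_fst (X := ℝ) (Y := ℝ)).add continuous_snd).div_const 2)
    exact ((h1.add h2).div_const 2).sub h3
  set F : ℝ × ℝ → ℝ := fun z => |z.1 - z.2| ^ p - ε * (|z.1| ^ p + |z.2| ^ p) with hF
  have hFc : Continuous F := by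
    have h1 := hc.comp (continuous_fst (X := ℝ) (Y := ℝ))
    have h2 := hc.comp (continuous_snd (X := ℝ) (Y := ℝ))
    have h3 := hc.comp ((continuous_fst (X := ℝ) (Y := ℝ)).sub continuous_snd)
    exact h3.sub (continuous_const.mul (h1.add h2))
  have hDpos : ∀ z : ℝ × ℝ, z.1 ≠ z.2 → 0 < D z := by
    intro z hz
    have := (strictConvexOn_abs_rpow hp).2 (Set.mem_univ z.1) (Set.mem_univ z.2) hz
      (by norm_num : (0 : ℝ) < 1 / 2) (by norm_num : (0 : ℝ) < 1 / 2) (by norm_num)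
    simp only [smul_eq_mul] at this
    rw [show (1 / 2 * z.1 + 1 / 2 * z.2 : ℝ) = (z.1 + z.2) / 2 by ring] at this
    simp only [hD]
    linarith
  have hDnn : ∀ z : ℝ × ℝ, 0 ≤ D z := by
    intro z
    by_cases hz : z.1 = z.2
    · simp only [hD, hz]
      rw [show (z.2 + z.2) / 2 = z.2 by ring]
      linarith
    · exact (hDpos z hz).le
  -- Outside `S` the term with `ε` alone suffices on the sphere. `S` is compact and misses the
  -- diagonal, the only place where `D` vanishes, so `D` is bounded below there by some `δ > 0`.
  set S : Set (ℝ × ℝ) := Metric.sphere 0 1 ∩ {z | 0 ≤ F z} with hS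
  have hScomp : IsCompact S :=
    (isCompact_sphere _ _).inter_right (isClosed_le continuous_const hFc)
  have hSD : ∀ z ∈ S, 0 < D z := by
    rintro z ⟨hz1, hz2⟩
    refine hDpos z fun h => ?_
    have hn : z.2 ≠ 0 := by
      intro h0
      have : z = 0 := Prod.ext (h.trans h0) h0
      simp [this] at hz1
    have : 0 < |z.2| ^ p := Real.rpow_pos_of_pos (abs_pos.2 hn) _
    simp only [hF, h, sub_self, abs_zero, Real.zero_rpow hp0.ne', Set.mem_ofPred_eq] at hz2
    nlinarith
  obtain ⟨δ, hδ, hδS⟩ : ∃ δ : ℝ, 0 < δ ∧ ∀ z ∈ S, δ ≤ D z := by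
    rcases S.eq_empty_or_nonempty with h | h
    · exact ⟨1, one_pos, by simp [h]⟩
    · obtain ⟨z, hz, hmin⟩ := hScomp.exists_isMinOn h hDc.continuousOn
      exact ⟨D z, hSD z hz, fun y hy => hmin hy⟩
  have h2p : (0 : ℝ) ≤ 2 ^ p := Real.rpow_nonneg (by norm_num) _
  have hsphere : ∀ z : ℝ × ℝ, ‖z‖ = 1 →
      |z.1 - z.2| ^ p ≤ 2 ^ p / δ * D z + ε * (|z.1| ^ p + |z.2| ^ p) := by
    intro z hz
    have hnn : 0 ≤ ε * (|z.1| ^ p + |z.2| ^ p) := by positivity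
    by_cases hzF : 0 ≤ F z
    · have hd := hδS z ⟨by simpa using hz, hzF⟩
      have h1 : |z.1 - z.2| ≤ 2 := by
        have e1 : |z.1| ≤ 1 := hz ▸ norm_fst_le z
        have e2 : |z.2| ≤ 1 := hz ▸ norm_snd_le z
        exact (abs_sub _ _).trans (by linarith)
      have h2 : |z.1 - z.2| ^ p ≤ 2 ^ p := Real.rpow_le_rpow (abs_nonneg _) h1 hp0.le
      have h3 : (2 : ℝ) ^ p ≤ 2 ^ p / δ * D z := by
        rw [div_mul_eq_mul_div, le_div_iff₀ hδ]
        exact mul_le_mul_of_nonneg_left hd h2p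
      linarith
    · have : 0 ≤ 2 ^ p / δ * D z := mul_nonneg (by positivity) (hDnn z)
      simp only [hF, not_le] at hzF
      linarith
  refine ⟨2 ^ p / δ, by positivity, fun a b => ?_⟩
  by_cases hab : ((a, b) : ℝ × ℝ) = 0
  · obtain ⟨rfl, rfl⟩ := Prod.mk_eq_zero.1 hab
    simp [Real.zero_rpow hp0.ne']
  -- Both sides are homogeneous of degree `p`, so the bound on the sphere extends by scaling.
  · set t := ‖((a, b) : ℝ × ℝ)‖ with ht
    have htpos : 0 < t := norm_pos_iff.2 hab
    have hk := hsphere (t⁻¹ • (a, b)) (by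
      rw [norm_smul, Real.norm_of_nonneg (by positivity), ← ht, inv_mul_cancel₀ htpos.ne'])
    have hsc : ∀ x : ℝ, |t⁻¹ * x| ^ p = (t ^ p)⁻¹ * |x| ^ p := by
      intro x
      rw [abs_mul, abs_of_pos (inv_pos.2 htpos), Real.mul_rpow (inv_pos.2 htpos).le (abs_nonneg _),
        Real.inv_rpow htpos.le]
    simp only [hD, Prod.smul_fst, Prod.smul_snd, smul_eq_mul] at hk
    rw [← mul_sub, ← mul_add, mul_div_assoc, hsc, hsc, hsc, hsc] at hk
    have htp : 0 < t ^ p := Real.rpow_pos_of_pos htpos _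
    have := mul_le_mul_of_nonneg_left hk htp.le
    field_simp at this ⊢
    linarith

theorem Lp_norm_rpow_eq_integral {Ω : Type*} {mΩ : MeasurableSpace Ω} {μ : Measure Ω} {p : ℝ≥0}
    (hp : 0 < p) (u : Lp ℝ p μ) : ‖u‖ ^ (p : ℝ) = ∫ ω, |u ω| ^ (p : ℝ) ∂μ := by
  have hp' : (p : ℝ≥0∞) ≠ 0 := by exact_mod_cast hp.ne'
  have := (Lp.memLp u).eLpNorm_eq_integral_rpow_norm hp' ENNReal.coe_ne_top
  rw [Lp.norm_def, this, ENNReal.toReal_ofReal (by positivity), ENNReal.coe_toReal,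
    ← Real.rpow_mul (by positivity), inv_mul_cancel₀ (by positivity), Real.rpow_one]
  rfl

/-- Choice of a convergent selection from a decreasing sequence of bounded midpoint convex sets
in `L^p`, `1 < p < ∞`. -/
theorem Lp_exists_tendsto_of_antitone {Ω : Type*} {mΩ : MeasurableSpace Ω} {μ : Measure Ω}
    {p : ℝ≥0} [Fact (1 ≤ (p : ℝ≥0∞))] (hp : 1 < p) {C : ℕ → Set (Lp ℝ p μ)} (hanti : Antitone C)
    (hne : ∀ n, (C n).Nonempty)
    (hmid : ∀ n, ∀ u ∈ C n, ∀ v ∈ C n, (1 / 2 : ℝ) • (u + v) ∈ C n)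
    {R : ℝ} (hR : ∀ u ∈ C 0, ‖u‖ ≤ R) :
    ∃ u : ℕ → Lp ℝ p μ, (∀ n, u n ∈ C n) ∧ ∃ l, Tendsto u atTop (𝓝 l) := by
  have hp1 : 1 < (p : ℝ) := by exact_mod_cast hp
  have hp0 : 0 < (p : ℝ) := by linarith
  have hpn : 0 < p := zero_lt_one.trans hp
  set N : Lp ℝ p μ → ℝ := fun u => ‖u‖ ^ (p : ℝ) with hN
  have hNnn : ∀ u, 0 ≤ N u := fun u => by positivity
  have hbdd : ∀ n, BddBelow (N '' C n) := fun n => ⟨0, by rintro _ ⟨u, -, rfl⟩; exact hNnn u⟩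
  have hR0 : ∀ u ∈ C 0, N u ≤ R ^ (p : ℝ) := fun u hu =>
    Real.rpow_le_rpow (norm_nonneg _) (hR u hu) hp0.le
  have hCn : ∀ n, ∀ u ∈ C n, N u ≤ R ^ (p : ℝ) := fun n u hu => hR0 u (hanti (Nat.zero_le n) hu)
  -- The infima increase and are bounded, hence converge to `A`. A midpoint of two elements of `C n`
  -- cannot go below `a n`, so almost minimal elements have a small convexity defect.
  set a : ℕ → ℝ := fun n => sInf (N '' C n) with ha
  have hale : ∀ n, ∀ u ∈ C n, a n ≤ N u := fun n u hu => csInf_le (hbdd n) ⟨u, hu, rfl⟩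
  have hamono : Monotone a := fun n k hnk =>
    csInf_le_csInf (hbdd n) ((hne k).image N) (Set.image_mono (hanti hnk))
  have habdd : BddAbove (Set.range a) := ⟨R ^ (p : ℝ), by
    rintro _ ⟨n, rfl⟩
    obtain ⟨u, hu⟩ := hne n
    exact (hale n u hu).trans (hCn n u hu)⟩
  have halim := tendsto_atTop_ciSup hamono habdd
  set A := ⨆ n, a n
  have haA : ∀ n, a n ≤ A := fun n => le_ciSup habdd n
  have hex : ∀ n : ℕ, ∃ u ∈ C n, N u < a n + 1 / ((n : ℝ) + 1) := by
    intro n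
    obtain ⟨_, ⟨u, hu, rfl⟩, hlt⟩ :=
      exists_lt_of_csInf_lt ((hne n).image N) (lt_add_of_pos_right (a n)
        (Nat.one_div_pos_of_nat (α := ℝ) (n := n)))
    exact ⟨u, hu, hlt⟩
  choose u huC huN using hex
  refine ⟨u, huC, ?_⟩
  have hint : ∀ v : Lp ℝ p μ, Integrable (fun ω => |v ω| ^ (p : ℝ)) μ := by
    intro v
    have := (Lp.memLp v).integrable_norm_rpow (by exact_mod_cast hpn.ne') ENNReal.coe_ne_top
    simpa using this
  have hkey : ∀ ε : ℝ, 0 < ε → ∃ K : ℝ, 0 ≤ K ∧ ∀ v w : Lp ℝ p μ,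
      N (v - w) ≤ K * ((N v + N w) / 2 - N ((1 / 2 : ℝ) • (v + w))) + ε * (N v + N w) := by
    intro ε hε
    obtain ⟨K, hK, h⟩ := exists_abs_sub_rpow_le hp1 hε
    refine ⟨K, hK, fun v w => ?_⟩
    simp only [hN, Lp_norm_rpow_eq_integral hpn]
    rw [← integral_add (hint v) (hint w), ← integral_div, ← integral_sub, ← integral_const_mul,
      ← integral_const_mul, ← integral_add]
    · refine integral_mono_ae (hint _) ?_ ?_
      · exact (((((hint v).add (hint w)).div_const 2).sub (hint _)).const_mul K).add
          (((hint v).add (hint w)).const_mul ε)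
      · filter_upwards [Lp.coeFn_sub v w, Lp.coeFn_smul (1 / 2 : ℝ) (v + w), Lp.coeFn_add v w]
          with ω h1 h2 h3
        simp only [h1, h2, h3, Pi.sub_apply, Pi.smul_apply, Pi.add_apply, smul_eq_mul]
        have := h (v ω) (w ω)
        rwa [show 1 / 2 * (v ω + w ω) = (v ω + w ω) / 2 by ring]
    · exact ((((hint v).add (hint w)).div_const 2).sub (hint _)).const_mul K
    · exact ((hint v).add (hint w)).const_mul ε
    · exact ((hint v).add (hint w)).div_const 2
    · exact hint _
  have hcauchy : CauchySeq u := by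
    rw [Metric.cauchySeq_iff']
    intro e he
    have hep : 0 < e ^ (p : ℝ) := Real.rpow_pos_of_pos he _
    -- `B` bounds `N` on every `C n`. With `ε = e ^ p / (4 * B)` the error term is at most `e ^ p /
    -- 2`, leaving the other half for the convexity defect.
    set B := |R ^ (p : ℝ)| + 1 with hB
    have hBpos : 0 < B := by positivity
    obtain ⟨K, hK, hKle⟩ := hkey (e ^ (p : ℝ) / (4 * B)) (by positivity)
    have hlim : Tendsto (fun n : ℕ => K * (A + 1 / ((n : ℝ) + 1) - a n)) atTop (𝓝 0) := by
      have := ((tendsto_const_nhds (x := A)).add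
        (tendsto_one_div_add_atTop_nhds_zero_nat (𝕜 := ℝ))).sub halim
      simpa using this.const_mul K
    obtain ⟨n, hn⟩ := (hlim.eventually (gt_mem_nhds (by positivity : 0 < e ^ (p : ℝ) / 2))).exists
    refine ⟨n, fun k hk => ?_⟩
    rw [dist_eq_norm]
    have hkn : u k ∈ C n := hanti hk (huC k)
    have h1 := hKle (u k) (u n)
    have h2 := hale n _ (hmid n _ hkn _ (huC n))
    have h3 := huN k
    have h4 := huN n
    have h5 : (1 : ℝ) / ((k : ℝ) + 1) ≤ 1 / ((n : ℝ) + 1) := by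
      have : (n : ℝ) ≤ k := by exact_mod_cast hk
      gcongr
    have h6 : K * ((N (u k) + N (u n)) / 2 - N ((1 / 2 : ℝ) • (u k + u n))) ≤
        K * (A + 1 / ((n : ℝ) + 1) - a n) :=
      mul_le_mul_of_nonneg_left (by linarith [haA k, haA n]) hK
    have h7 : e ^ (p : ℝ) / (4 * B) * (N (u k) + N (u n)) ≤ e ^ (p : ℝ) / (4 * B) * (2 * B) := by
      refine mul_le_mul_of_nonneg_left ?_ (by positivity)
      linarith [hCn n _ hkn, hCn n _ (huC n), le_abs_self (R ^ (p : ℝ))]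
    have h8 : e ^ (p : ℝ) / (4 * B) * (2 * B) = e ^ (p : ℝ) / 2 := by field_simp; norm_num
    have h9 : ‖u k - u n‖ ^ (p : ℝ) < e ^ (p : ℝ) := by
      change N (u k - u n) < _
      linarith
    exact (Real.rpow_lt_rpow_iff (norm_nonneg _) he.le hp0).1 h9
  exact cauchySeq_tendsto_of_complete hcauchy

namespace CondRisk

/-! ### Calculus of conditional expectations and `L⁰`-norms. -/

section Basic

variable {Ω : Type*} {m mΩ : MeasurableSpace Ω} {P : Measure Ω} {p : ℝ≥0}

/-- The conditional expectation is local. -/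
theorem condLExp_congr_on {s : Set Ω} (hs : MeasurableSet[m] s) {X Y : Ω → ℝ≥0∞}
    (hX : AEMeasurable X P) (hY : AEMeasurable Y P) (h : ∀ᵐ ω ∂P, ω ∈ s → X ω = Y ω) :
    ∀ᵐ ω ∂P, ω ∈ s → condLExp m P X ω = condLExp m P Y ω := by
  have hI : Measurable[m] (s.indicator (1 : Ω → ℝ≥0∞)) :=
    (measurable_const (a := (1 : ℝ≥0∞))).indicator hs
  have hXY : (fun ω => s.indicator (1 : Ω → ℝ≥0∞) ω * X ω) =ᵐ[P]
      fun ω => s.indicator (1 : Ω → ℝ≥0∞) ω * Y ω := by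
    filter_upwards [h] with ω hω
    by_cases hs : ω ∈ s
    · rw [hω hs]
    · simp [hs]
  filter_upwards [condLExp_mul_left hI hX, condLExp_mul_left hI hY,
    condLExp_congr_ae (mΩ := m) hXY] with ω h1 h2 h3 hω
  rw [h3, h2] at h1
  simpa [hω] using h1.symm

theorem L0_exists_measurable (c : L0 m P) :
    ∃ g : Ω → ℝ, Measurable[m] g ∧ (c : Ω →ₘ[P] ℝ) =ᵐ[P] g := by
  obtain ⟨g, hg, h⟩ := c.2
  exact ⟨g, hg.measurable, h⟩

theorem L0bar_exists_measurable (c : L0bar m P) :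
    ∃ g : Ω → EReal, Measurable[m] g ∧ c.1 =ᵐ[P] g := by
  obtain ⟨g, hg, h⟩ := c.2
  exact ⟨g, hg.measurable, h⟩

theorem coeFn_mkL0 (hm : m ≤ mΩ) {g : Ω → ℝ} (hg : Measurable[m] g) :
    (mkL0 P hm g hg : Ω →ₘ[P] ℝ) =ᵐ[P] g :=
  AEEqFun.coeFn_mk _ _

/-- The indicator of a set of the sub-σ-algebra, in `L⁰(ℱ)`. -/
def indL0 (P : Measure Ω) (hm : m ≤ mΩ) {A : Set Ω} (hA : MeasurableSet[m] A) : L0 m P :=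
  mkL0 P hm (A.indicator 1) ((measurable_const (a := (1 : ℝ))).indicator hA)

theorem coeFn_indL0 (hm : m ≤ mΩ) {A : Set Ω} (hA : MeasurableSet[m] A) :
    (indL0 P hm hA : Ω →ₘ[P] ℝ) =ᵐ[P] A.indicator 1 :=
  coeFn_mkL0 hm _

theorem indL0_nonneg (hm : m ≤ mΩ) {A : Set Ω} (hA : MeasurableSet[m] A) :
    (0 : Ω →ₘ[P] ℝ) ≤ indL0 P hm hA := by
  rw [← AEEqFun.coeFn_le]
  filter_upwards [coeFn_indL0 (P := P) hm hA, AEEqFun.coeFn_zero (α := Ω) (μ := P) (β := ℝ)]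
    with ω h1 h2
  rw [h1, h2]
  exact Set.indicator_nonneg (fun _ _ => zero_le_one) ω

theorem indL0_le_one (hm : m ≤ mΩ) {A : Set Ω} (hA : MeasurableSet[m] A) :
    (indL0 P hm hA : Ω →ₘ[P] ℝ) ≤ 1 := by
  rw [← AEEqFun.coeFn_le]
  filter_upwards [coeFn_indL0 (P := P) hm hA, AEEqFun.coeFn_one (α := Ω) (μ := P) (β := ℝ)]
    with ω h1 h2
  rw [h1, h2]
  exact Set.indicator_le_self' (fun _ _ => zero_le_one) ω

theorem coeFn_convexComb (x y : condLp m P p) (ξ : L0 m P) :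
    ((ξ • x + (1 - ξ) • y : condLp m P p) : Ω →ₘ[P] ℝ) =ᵐ[P] fun ω =>
      (ξ : Ω →ₘ[P] ℝ) ω * (x : Ω →ₘ[P] ℝ) ω +
        (1 - (ξ : Ω →ₘ[P] ℝ) ω) * (y : Ω →ₘ[P] ℝ) ω := by
  filter_upwards [AEEqFun.coeFn_add ((ξ : Ω →ₘ[P] ℝ) * (x : Ω →ₘ[P] ℝ))
      ((1 - ξ : Ω →ₘ[P] ℝ) * (y : Ω →ₘ[P] ℝ)),
    AEEqFun.coeFn_mul (ξ : Ω →ₘ[P] ℝ) (x : Ω →ₘ[P] ℝ),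
    AEEqFun.coeFn_mul (1 - ξ : Ω →ₘ[P] ℝ) (y : Ω →ₘ[P] ℝ),
    AEEqFun.coeFn_sub (1 : Ω →ₘ[P] ℝ) ξ, AEEqFun.coeFn_one (α := Ω) (μ := P) (β := ℝ)]
    with ω h1 h2 h3 h4 h5
  change ((ξ : Ω →ₘ[P] ℝ) * (x : Ω →ₘ[P] ℝ) + (1 - ξ : Ω →ₘ[P] ℝ) * (y : Ω →ₘ[P] ℝ) : Ω →ₘ[P] ℝ) ω = _
  rw [h1, Pi.add_apply, h2, h3, Pi.mul_apply, Pi.mul_apply, h4, Pi.sub_apply, h5, Pi.one_apply]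

theorem coeFn_paste (hm : m ≤ mΩ) {A : Set Ω} (hA : MeasurableSet[m] A) (x y : condLp m P p) :
    ∀ᵐ ω ∂P,
      (ω ∈ A → ((indL0 P hm hA • x + (1 - indL0 P hm hA) • y : condLp m P p) : Ω →ₘ[P] ℝ) ω =
        (x : Ω →ₘ[P] ℝ) ω) ∧
      (ω ∉ A → ((indL0 P hm hA • x + (1 - indL0 P hm hA) • y : condLp m P p) : Ω →ₘ[P] ℝ) ω =
        (y : Ω →ₘ[P] ℝ) ω) := by
  filter_upwards [coeFn_convexComb x y (indL0 P hm hA), coeFn_indL0 (P := P) hm hA] with ω h1 h2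
  rw [h1, h2]
  constructor <;> intro h <;> simp [h]

theorem coeFn_condNorm (hm : m ≤ mΩ) (x : condLp m P p) :
    (condNorm hm x : Ω →ₘ[P] ℝ) =ᵐ[P] fun ω => (condPow m P p x ω).toReal ^ (1 / (p : ℝ)) :=
  coeFn_mkL0 hm _

/-- Passes from the real-valued norm to `condPow` in `[0, ∞]`, where limits and monotonicity are
easier. The `toReal` in `condNorm` loses nothing because `condPow` is a.s. finite on `condLp`. -/
theorem condNorm_le_iff (hm : m ≤ mΩ) (hp : 0 < p) (x : condLp m P p) {r : L0 m P}
    (hr : IsPos r) : (condNorm hm x : Ω →ₘ[P] ℝ) ≤ r ↔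
      ∀ᵐ ω ∂P, condPow m P p x ω ≤ ENNReal.ofReal ((r : Ω →ₘ[P] ℝ) ω) ^ (p : ℝ) := by
  have hx : ∀ᵐ ω ∂P, condPow m P p x ω < ∞ := x.2
  have hp' : 0 < (p : ℝ) := by exact_mod_cast hp
  rw [← AEEqFun.coeFn_le]
  refine eventually_congr ?_
  filter_upwards [coeFn_condNorm hm x, hr, hx] with ω h1 h2 h3
  rw [h1, ENNReal.ofReal_rpow_of_nonneg h2.le hp'.le, ENNReal.le_ofReal_iff_toReal_le h3.ne
    (by positivity), one_div, Real.rpow_inv_le_iff_of_pos ENNReal.toReal_nonneg h2.le hp']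

/-- `L⁰`-convexity of `E[|·| ^ p | ℱ]`. -/
theorem condPow_convexComb_le (hm : m ≤ mΩ) (hp : 1 ≤ p) (x y : condLp m P p) {ξ : L0 m P}
    (h0 : (0 : Ω →ₘ[P] ℝ) ≤ ξ) (h1 : (ξ : Ω →ₘ[P] ℝ) ≤ 1) :
    ∀ᵐ ω ∂P, condPow m P p (ξ • x + (1 - ξ) • y : condLp m P p) ω ≤
      ENNReal.ofReal ((ξ : Ω →ₘ[P] ℝ) ω) * condPow m P p x ω +
        ENNReal.ofReal (1 - (ξ : Ω →ₘ[P] ℝ) ω) * condPow m P p y ω := by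
  have hp' : 1 ≤ (p : ℝ) := by exact_mod_cast hp
  obtain ⟨g, hg, hξg⟩ := L0_exists_measurable ξ
  have hg1 : Measurable[m] fun ω => ENNReal.ofReal (g ω) := hg.ennreal_ofReal
  have hg2 : Measurable[m] fun ω => ENNReal.ofReal (1 - g ω) :=
    (measurable_const.sub hg).ennreal_ofReal
  have hX := measurable_enorm_rpow p (x : Ω →ₘ[P] ℝ)
  have hY := measurable_enorm_rpow p (y : Ω →ₘ[P] ℝ)
  have hle : (fun ω => ‖((ξ • x + (1 - ξ) • y : condLp m P p) : Ω →ₘ[P] ℝ) ω‖ₑ ^ (p : ℝ)) ≤ᵐ[P]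
      (fun ω => ENNReal.ofReal (g ω) * ‖(x : Ω →ₘ[P] ℝ) ω‖ₑ ^ (p : ℝ)) +
        fun ω => ENNReal.ofReal (1 - g ω) * ‖(y : Ω →ₘ[P] ℝ) ω‖ₑ ^ (p : ℝ) := by
    rw [← AEEqFun.coeFn_le] at h0 h1
    filter_upwards [coeFn_convexComb x y ξ, hξg, h0, h1,
      AEEqFun.coeFn_zero (α := Ω) (μ := P) (β := ℝ),
      AEEqFun.coeFn_one (α := Ω) (μ := P) (β := ℝ)] with ω e1 e2 e3 e4 e5 e6
    rw [e5] at e3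
    rw [e6] at e4
    rw [e2] at e1 e3 e4
    simp only [Pi.zero_apply, Pi.one_apply] at e3 e4
    rw [e1, Pi.add_apply]
    refine (ENNReal.rpow_le_rpow (enorm_add_le _ _) (by positivity)).trans ?_
    rw [enorm_mul, enorm_mul, Real.enorm_of_nonneg e3, Real.enorm_of_nonneg (sub_nonneg.2 e4)]
    refine ENNReal.rpow_arith_mean_le_arith_mean2_rpow _ _ _ _ ?_ hp'
    rw [← ENNReal.ofReal_add e3 (sub_nonneg.2 e4)]
    simp
  filter_upwards [condLExp_mono (mΩ := m) hle, condLExp_add_left (mΩ := m) (P := P)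
    (X := fun ω => ENNReal.ofReal (g ω) * ‖(x : Ω →ₘ[P] ℝ) ω‖ₑ ^ (p : ℝ))
    (fun ω => ENNReal.ofReal (1 - g ω) * ‖(y : Ω →ₘ[P] ℝ) ω‖ₑ ^ (p : ℝ))
    ((hg1.mono hm le_rfl).mul hX).aemeasurable,
    condLExp_mul_left hg1 hX.aemeasurable, condLExp_mul_left hg2 hY.aemeasurable, hξg]
    with ω e1 e2 e3 e4 e5
  rw [e5]
  refine e1.trans_eq ?_
  rw [e2, Pi.add_apply, e3, e4]
  rfl

theorem condLExp_const_mul {X : Ω → ℝ≥0∞} (hX : AEMeasurable X P) (c : ℝ≥0∞) :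
    condLExp m P (fun ω => c * X ω) =ᵐ[P] fun ω => c * condLExp m P X ω :=
  condLExp_mul_left measurable_const hX

/-- Convexity of `z ↦ z ^ p` applied to `x + y = s (x / s) + t (y / t)`. As `s → 1` the coefficient
of the first term tends to `1`, which lets this bound stand in for a conditional Minkowski
inequality. -/
theorem condPow_add_le (hp : 1 ≤ p) {s t : ℝ≥0} (hs : s ≠ 0) (ht : t ≠ 0) (hst : s + t = 1)
    (x y : Ω →ₘ[P] ℝ) :
    ∀ᵐ ω ∂P, condPow m P p (x + y) ω ≤
      (s : ℝ≥0∞) ^ (1 - p : ℝ) * condPow m P p x ω +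
        (t : ℝ≥0∞) ^ (1 - p : ℝ) * condPow m P p y ω := by
  have hp' : 1 ≤ (p : ℝ) := by exact_mod_cast hp
  have hX := measurable_enorm_rpow p x
  have hY := measurable_enorm_rpow p y
  have key : ∀ (s : ℝ≥0) (z : ℝ≥0∞), s ≠ 0 →
      (s : ℝ≥0∞) * ((s : ℝ≥0∞)⁻¹ * z) ^ (p : ℝ) = (s : ℝ≥0∞) ^ (1 - p : ℝ) * z ^ (p : ℝ) := by
    intro s z hs
    have hs' : (s : ℝ≥0∞) ≠ 0 := by exact_mod_cast hs
    rw [ENNReal.mul_rpow_of_nonneg _ _ (by positivity), ← mul_assoc, ENNReal.inv_rpow,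
      ← ENNReal.rpow_neg, sub_eq_add_neg, ENNReal.rpow_add _ _ hs' ENNReal.coe_ne_top,
      ENNReal.rpow_one]
  have hle : (fun ω => ‖(x + y : Ω →ₘ[P] ℝ) ω‖ₑ ^ (p : ℝ)) ≤ᵐ[P]
      (fun ω => (s : ℝ≥0∞) ^ (1 - p : ℝ) * ‖x ω‖ₑ ^ (p : ℝ)) +
        fun ω => (t : ℝ≥0∞) ^ (1 - p : ℝ) * ‖y ω‖ₑ ^ (p : ℝ) := by
    filter_upwards [AEEqFun.coeFn_add x y] with ω e1
    rw [e1, Pi.add_apply, Pi.add_apply, ← key s _ hs, ← key t _ ht]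
    refine le_trans ?_ (ENNReal.rpow_arith_mean_le_arith_mean2_rpow _ _ _ _
      (by exact_mod_cast hst) hp')
    refine ENNReal.rpow_le_rpow ?_ (by positivity)
    rw [← mul_assoc, ← mul_assoc, ENNReal.mul_inv_cancel (by exact_mod_cast hs) ENNReal.coe_ne_top,
      ENNReal.mul_inv_cancel (by exact_mod_cast ht) ENNReal.coe_ne_top, one_mul, one_mul]
    exact enorm_add_le _ _
  filter_upwards [condLExp_mono (mΩ := m) hle, condLExp_add_left (mΩ := m) (P := P)
    (X := fun ω => (s : ℝ≥0∞) ^ (1 - p : ℝ) * ‖x ω‖ₑ ^ (p : ℝ))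
    (fun ω => (t : ℝ≥0∞) ^ (1 - p : ℝ) * ‖y ω‖ₑ ^ (p : ℝ))
    (hX.const_mul _).aemeasurable,
    condLExp_const_mul hX.aemeasurable ((s : ℝ≥0∞) ^ (1 - p : ℝ)),
    condLExp_const_mul hY.aemeasurable ((t : ℝ≥0∞) ^ (1 - p : ℝ))]
    with ω e1 e2 e3 e4
  refine e1.trans_eq ?_
  rw [e2, Pi.add_apply, e3, e4]
  rfl

/-- A conditional form of `|x| ≤ δ + δ ^ (1 - p) |x| ^ p`. -/
theorem condLExp_enorm_le [IsProbabilityMeasure P] (hm : m ≤ mΩ) (hp : 1 ≤ p) {δ : ℝ≥0}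
    (hδ : δ ≠ 0) (x : Ω →ₘ[P] ℝ) :
    ∀ᵐ ω ∂P, condLExp m P (fun ω => ‖x ω‖ₑ) ω ≤ δ + (δ : ℝ≥0∞) ^ (1 - p : ℝ) * condPow m P p x ω := by
  have hp' : 1 ≤ (p : ℝ) := by exact_mod_cast hp
  have hδ' : (δ : ℝ≥0∞) ≠ 0 := by exact_mod_cast hδ
  have hX := measurable_enorm_rpow p x
  -- For `z ≥ δ` one has `δ ^ (p - 1) ≤ z ^ (p - 1)`; multiply by `δ ^ (1 - p) * z`.
  have hpt : ∀ z : ℝ≥0∞, z ≤ δ + (δ : ℝ≥0∞) ^ (1 - p : ℝ) * z ^ (p : ℝ) := by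
    intro z
    rcases le_total z δ with h | h
    · exact h.trans le_self_add
    · refine le_trans ?_ le_add_self
      calc z = (δ : ℝ≥0∞) ^ (1 - p : ℝ) * ((δ : ℝ≥0∞) ^ (p - 1 : ℝ) * z) := by
            rw [← mul_assoc, ← ENNReal.rpow_add _ _ hδ' ENNReal.coe_ne_top]
            simp
        _ ≤ (δ : ℝ≥0∞) ^ (1 - p : ℝ) * (z ^ (p - 1 : ℝ) * z) := by
            gcongr
        _ = _ := by
            congr 1
            nth_rewrite 2 [← ENNReal.rpow_one z]
            rw [← ENNReal.rpow_add_of_nonneg _ _ (by linarith) (by norm_num)]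
            simp
  have hle : (fun ω => ‖x ω‖ₑ) ≤ᵐ[P]
      (fun _ => (δ : ℝ≥0∞)) + fun ω => (δ : ℝ≥0∞) ^ (1 - p : ℝ) * ‖x ω‖ₑ ^ (p : ℝ) :=
    Eventually.of_forall fun ω => hpt _
  filter_upwards [condLExp_mono (mΩ := m) hle, condLExp_add_left (mΩ := m) (P := P)
    (X := fun _ => (δ : ℝ≥0∞)) (fun ω => (δ : ℝ≥0∞) ^ (1 - p : ℝ) * ‖x ω‖ₑ ^ (p : ℝ))
    aemeasurable_const, condLExp_const_mul hX.aemeasurable ((δ : ℝ≥0∞) ^ (1 - p : ℝ))]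
    with ω e1 e2 e3
  refine e1.trans_eq ?_
  rw [e2, Pi.add_apply, e3, condLExp_const hm]
  rfl

theorem condLExp_enorm_lt_top [IsProbabilityMeasure P] (hm : m ≤ mΩ) (hp : 1 ≤ p)
    (x : condLp m P p) :
    ∀ᵐ ω ∂P, condLExp m P (fun ω => ‖(x : Ω →ₘ[P] ℝ) ω‖ₑ) ω < ∞ := by
  have hx : ∀ᵐ ω ∂P, condPow m P p x ω < ∞ := x.2
  filter_upwards [hx, condLExp_enorm_le hm hp one_ne_zero (x : Ω →ₘ[P] ℝ)] with ω h1 h2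
  refine h2.trans_lt ?_
  simpa using h1

theorem condLExp_ofReal_lt_top [IsProbabilityMeasure P] (hm : m ≤ mΩ) (hp : 1 ≤ p)
    (x : condLp m P p) :
    ∀ᵐ ω ∂P, condLExp m P (fun ω => ENNReal.ofReal ((x : Ω →ₘ[P] ℝ) ω)) ω < ∞ ∧
      condLExp m P (fun ω => ENNReal.ofReal (-(x : Ω →ₘ[P] ℝ) ω)) ω < ∞ := by
  have h1 : (fun ω => ENNReal.ofReal ((x : Ω →ₘ[P] ℝ) ω)) ≤ᵐ[P]
      fun ω => ‖(x : Ω →ₘ[P] ℝ) ω‖ₑ := Eventually.of_forall fun ω => Real.ofReal_le_enorm _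
  have h2 : (fun ω => ENNReal.ofReal (-(x : Ω →ₘ[P] ℝ) ω)) ≤ᵐ[P]
      fun ω => ‖(x : Ω →ₘ[P] ℝ) ω‖ₑ := Eventually.of_forall fun ω => by
    beta_reduce
    rw [← enorm_neg]; exact Real.ofReal_le_enorm _
  filter_upwards [condLExp_enorm_lt_top hm hp x, condLExp_mono (mΩ := m) h1,
    condLExp_mono (mΩ := m) h2] with ω e1 e2 e3
  exact ⟨e2.trans_lt e1, e3.trans_lt e1⟩

theorem coeFn_condE (hm : m ≤ mΩ) (x : Ω →ₘ[P] ℝ) :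
    (condE hm x : Ω →ₘ[P] ℝ) =ᵐ[P] fun ω =>
      (condLExp m P (fun ω => ENNReal.ofReal (x ω)) ω).toReal -
        (condLExp m P (fun ω => ENNReal.ofReal (-x ω)) ω).toReal :=
  coeFn_mkL0 hm _

/-- The conditional expectation can be computed from any decomposition as a difference of
nonnegative random variables. -/
theorem condE_eq_of_add_eq [IsProbabilityMeasure P] (hm : m ≤ mΩ) (hp : 1 ≤ p) (x : condLp m P p)
    {f g : Ω → ℝ≥0∞} (hf : AEMeasurable f P) (hg : AEMeasurable g P)
    (hf' : ∀ᵐ ω ∂P, condLExp m P f ω < ∞) (hg' : ∀ᵐ ω ∂P, condLExp m P g ω < ∞)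
    (h : ∀ᵐ ω ∂P, ENNReal.ofReal ((x : Ω →ₘ[P] ℝ) ω) + g ω =
      f ω + ENNReal.ofReal (-(x : Ω →ₘ[P] ℝ) ω)) :
    (condE hm (x : Ω →ₘ[P] ℝ) : Ω →ₘ[P] ℝ) =ᵐ[P] fun ω =>
      (condLExp m P f ω).toReal - (condLExp m P g ω).toReal := by
  have h' : (fun ω => ENNReal.ofReal ((x : Ω →ₘ[P] ℝ) ω)) + g =ᵐ[P]
      f + fun ω => ENNReal.ofReal (-(x : Ω →ₘ[P] ℝ) ω) := h
  filter_upwards [coeFn_condE hm (x : Ω →ₘ[P] ℝ), condLExp_ofReal_lt_top hm hp x, hf', hg',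
    condLExp_congr_ae (mΩ := m) h', condLExp_add_right (mΩ := m) (P := P)
      (fun ω => ENNReal.ofReal ((x : Ω →ₘ[P] ℝ) ω)) hg,
    condLExp_add_left (mΩ := m) (P := P)
      (fun ω => ENNReal.ofReal (-(x : Ω →ₘ[P] ℝ) ω)) hf] with ω e1 e2 e3 e4 e5 e6 e7
  rw [e6, e7, Pi.add_apply, Pi.add_apply] at e5
  have := congrArg ENNReal.toReal e5
  rw [ENNReal.toReal_add e2.1.ne e4.ne, ENNReal.toReal_add e3.ne e2.2.ne] at this
  rw [e1]
  linarith

/-- Substituting `z⁺ = z + z⁻` leaves a linear identity. The additive form avoids the truncated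
subtraction of `ℝ≥0∞` and is the one required by `condE_eq_of_add_eq`. -/
theorem ofReal_convexComb_add (ξ x y : ℝ) (h0 : 0 ≤ ξ) (h1 : ξ ≤ 1) :
    ENNReal.ofReal (ξ * x + (1 - ξ) * y) +
        (ENNReal.ofReal ξ * ENNReal.ofReal (-x) + ENNReal.ofReal (1 - ξ) * ENNReal.ofReal (-y)) =
      (ENNReal.ofReal ξ * ENNReal.ofReal x + ENNReal.ofReal (1 - ξ) * ENNReal.ofReal y) +
        ENNReal.ofReal (-(ξ * x + (1 - ξ) * y)) := by
  have h1' := sub_nonneg.2 h1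
  have key : ∀ z : ℝ, max z 0 = z + max (-z) 0 := by
    intro z
    rcases le_total z 0 with h | h
    · rw [max_eq_right h, max_eq_left (by linarith)]; ring
    · rw [max_eq_left h, max_eq_right (by linarith)]; ring
  have hof : ∀ z : ℝ, ENNReal.ofReal z = ENNReal.ofReal (max z 0) := fun z => by
    rw [ENNReal.ofReal_max]; simp
  simp only [hof x, hof y, hof (-x), hof (-y), hof (ξ * x + (1 - ξ) * y),
    hof (-(ξ * x + (1 - ξ) * y))]
  rw [← ENNReal.ofReal_mul h0, ← ENNReal.ofReal_mul h0, ← ENNReal.ofReal_mul h1',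
    ← ENNReal.ofReal_mul h1', ← ENNReal.ofReal_add (by positivity) (by positivity),
    ← ENNReal.ofReal_add (by positivity) (by positivity),
    ← ENNReal.ofReal_add (by positivity) (by positivity),
    ← ENNReal.ofReal_add (by positivity) (by positivity)]
  congr 1
  rw [key x, key y, key (ξ * x + (1 - ξ) * y)]
  ring

theorem condE_convexComb [IsProbabilityMeasure P] (hm : m ≤ mΩ) (hp : 1 ≤ p) (x y : condLp m P p)
    {ξ : L0 m P} (h0 : (0 : Ω →ₘ[P] ℝ) ≤ ξ) (h1 : (ξ : Ω →ₘ[P] ℝ) ≤ 1) :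
    (condE hm ((ξ • x + (1 - ξ) • y : condLp m P p) : Ω →ₘ[P] ℝ) : Ω →ₘ[P] ℝ) =ᵐ[P] fun ω =>
      (ξ : Ω →ₘ[P] ℝ) ω * (condE hm (x : Ω →ₘ[P] ℝ) : Ω →ₘ[P] ℝ) ω +
        (1 - (ξ : Ω →ₘ[P] ℝ) ω) * (condE hm (y : Ω →ₘ[P] ℝ) : Ω →ₘ[P] ℝ) ω := by
  obtain ⟨g, hg, hξg⟩ := L0_exists_measurable ξ
  have hg1 : Measurable[m] fun ω => ENNReal.ofReal (g ω) := hg.ennreal_ofReal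
  have hg2 : Measurable[m] fun ω => ENNReal.ofReal (1 - g ω) :=
    (measurable_const.sub hg).ennreal_ofReal
  have hx1 : Measurable fun ω => ENNReal.ofReal ((x : Ω →ₘ[P] ℝ) ω) :=
    (x : Ω →ₘ[P] ℝ).measurable.ennreal_ofReal
  have hx2 : Measurable fun ω => ENNReal.ofReal (-(x : Ω →ₘ[P] ℝ) ω) :=
    (x : Ω →ₘ[P] ℝ).measurable.neg.ennreal_ofReal
  have hy1 : Measurable fun ω => ENNReal.ofReal ((y : Ω →ₘ[P] ℝ) ω) :=
    (y : Ω →ₘ[P] ℝ).measurable.ennreal_ofReal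
  have hy2 : Measurable fun ω => ENNReal.ofReal (-(y : Ω →ₘ[P] ℝ) ω) :=
    (y : Ω →ₘ[P] ℝ).measurable.neg.ennreal_ofReal
  have hrule : ∀ {X Y : Ω → ℝ≥0∞}, Measurable X → Measurable Y →
      condLExp m P ((fun ω => ENNReal.ofReal (g ω) * X ω) +
        fun ω => ENNReal.ofReal (1 - g ω) * Y ω) =ᵐ[P]
      fun ω => ENNReal.ofReal (g ω) * condLExp m P X ω +
        ENNReal.ofReal (1 - g ω) * condLExp m P Y ω := by
    intro X Y hX hY
    filter_upwards [condLExp_add_left (mΩ := m) (P := P)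
      (X := fun ω => ENNReal.ofReal (g ω) * X ω) (fun ω => ENNReal.ofReal (1 - g ω) * Y ω)
      ((hg1.mono hm le_rfl).mul hX).aemeasurable,
      condLExp_mul_left hg1 hX.aemeasurable, condLExp_mul_left hg2 hY.aemeasurable] with ω e1 e2 e3
    rw [e1, Pi.add_apply, e2, e3]
  have r1 := hrule hx1 hy1
  have r2 := hrule hx2 hy2
  have hx := condLExp_ofReal_lt_top hm hp x
  have hy := condLExp_ofReal_lt_top hm hp y
  rw [← AEEqFun.coeFn_le] at h0 h1
  have h0' : ∀ᵐ ω ∂P, 0 ≤ g ω ∧ g ω ≤ 1 := by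
    filter_upwards [h0, h1, hξg, AEEqFun.coeFn_zero (α := Ω) (μ := P) (β := ℝ),
      AEEqFun.coeFn_one (α := Ω) (μ := P) (β := ℝ)] with ω e1 e2 e3 e4 e5
    rw [e4, e3] at e1
    rw [e5, e3] at e2
    exact ⟨e1, e2⟩
  have hkey := condE_eq_of_add_eq hm hp (ξ • x + (1 - ξ) • y)
    (f := (fun ω => ENNReal.ofReal (g ω) * ENNReal.ofReal ((x : Ω →ₘ[P] ℝ) ω)) +
        fun ω => ENNReal.ofReal (1 - g ω) * ENNReal.ofReal ((y : Ω →ₘ[P] ℝ) ω))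
    (g := (fun ω => ENNReal.ofReal (g ω) * ENNReal.ofReal (-(x : Ω →ₘ[P] ℝ) ω)) +
        fun ω => ENNReal.ofReal (1 - g ω) * ENNReal.ofReal (-(y : Ω →ₘ[P] ℝ) ω))
    (((hg1.mono hm le_rfl).mul hx1).add ((hg2.mono hm le_rfl).mul hy1)).aemeasurable
    (((hg1.mono hm le_rfl).mul hx2).add ((hg2.mono hm le_rfl).mul hy2)).aemeasurable
    (by
      filter_upwards [r1, hx, hy] with ω e1 e2 e3
      rw [e1]
      exact ENNReal.add_lt_top.2 ⟨ENNReal.mul_lt_top ENNReal.ofReal_lt_top e2.1,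
        ENNReal.mul_lt_top ENNReal.ofReal_lt_top e3.1⟩)
    (by
      filter_upwards [r2, hx, hy] with ω e1 e2 e3
      rw [e1]
      exact ENNReal.add_lt_top.2 ⟨ENNReal.mul_lt_top ENNReal.ofReal_lt_top e2.2,
        ENNReal.mul_lt_top ENNReal.ofReal_lt_top e3.2⟩)
    (by
      filter_upwards [coeFn_convexComb x y ξ, hξg, h0'] with ω e1 e2 e3
      rw [e1, e2]
      exact ofReal_convexComb_add _ _ _ e3.1 e3.2)
  filter_upwards [hkey, r1, r2, hx, hy, h0', hξg, coeFn_condE hm (x : Ω →ₘ[P] ℝ),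
    coeFn_condE hm (y : Ω →ₘ[P] ℝ)] with ω e1 e2 e3 e4 e5 e6 e7 e8 e9
  rw [e1, e2, e3, e7, e8, e9, ENNReal.toReal_add, ENNReal.toReal_add, ENNReal.toReal_mul,
    ENNReal.toReal_mul, ENNReal.toReal_mul, ENNReal.toReal_mul, ENNReal.toReal_ofReal e6.1,
    ENNReal.toReal_ofReal (sub_nonneg.2 e6.2)]
  · ring
  · exact (ENNReal.mul_lt_top ENNReal.ofReal_lt_top e4.2).ne
  · exact (ENNReal.mul_lt_top ENNReal.ofReal_lt_top e5.2).ne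
  · exact (ENNReal.mul_lt_top ENNReal.ofReal_lt_top e4.1).ne
  · exact (ENNReal.mul_lt_top ENNReal.ofReal_lt_top e5.1).ne

/-- Positive and negative parts are both 1-Lipschitz, and each contributes one copy of `E[|x - y| |
ℱ]`. The resulting factor `2` is harmless for continuity. -/
theorem abs_condE_sub_le [IsProbabilityMeasure P] (hm : m ≤ mΩ) (hp : 1 ≤ p) (x y : condLp m P p) :
    ∀ᵐ ω ∂P, |(condE hm (x : Ω →ₘ[P] ℝ) : Ω →ₘ[P] ℝ) ω -
        (condE hm (y : Ω →ₘ[P] ℝ) : Ω →ₘ[P] ℝ) ω| ≤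
      2 * (condLExp m P (fun ω => ‖((x - y : condLp m P p) : Ω →ₘ[P] ℝ) ω‖ₑ) ω).toReal := by
  have hsub : ∀ x y : condLp m P p, ∀ᵐ ω ∂P,
      (condLExp m P (fun ω => ENNReal.ofReal ((x : Ω →ₘ[P] ℝ) ω)) ω).toReal ≤
        (condLExp m P (fun ω => ENNReal.ofReal ((y : Ω →ₘ[P] ℝ) ω)) ω).toReal +
          (condLExp m P (fun ω => ‖((x - y : condLp m P p) : Ω →ₘ[P] ℝ) ω‖ₑ) ω).toReal ∧
      (condLExp m P (fun ω => ENNReal.ofReal (-(x : Ω →ₘ[P] ℝ) ω)) ω).toReal ≤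
        (condLExp m P (fun ω => ENNReal.ofReal (-(y : Ω →ₘ[P] ℝ) ω)) ω).toReal +
          (condLExp m P (fun ω => ‖((x - y : condLp m P p) : Ω →ₘ[P] ℝ) ω‖ₑ) ω).toReal := by
    intro x y
    have hz : Measurable fun ω => ‖((x - y : condLp m P p) : Ω →ₘ[P] ℝ) ω‖ₑ :=
      ((x - y : condLp m P p) : Ω →ₘ[P] ℝ).measurable.enorm
    have hxy := AEEqFun.coeFn_sub (x : Ω →ₘ[P] ℝ) y
    have hpt : ∀ a b : ℝ, ENNReal.ofReal a ≤ ENNReal.ofReal b + ‖a - b‖ₑ := by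
      intro a b
      refine le_trans ?_ (add_le_add_right (Real.ofReal_le_enorm (a - b)) _)
      refine le_trans (le_of_eq (by ring_nf)) (ENNReal.ofReal_add_le (p := b) (q := a - b))
    have l1 : (fun ω => ENNReal.ofReal ((x : Ω →ₘ[P] ℝ) ω)) ≤ᵐ[P]
        (fun ω => ENNReal.ofReal ((y : Ω →ₘ[P] ℝ) ω)) +
          fun ω => ‖((x - y : condLp m P p) : Ω →ₘ[P] ℝ) ω‖ₑ := by
      filter_upwards [hxy] with ω e
      have e' : ((x - y : condLp m P p) : Ω →ₘ[P] ℝ) ω =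
        (x : Ω →ₘ[P] ℝ) ω - (y : Ω →ₘ[P] ℝ) ω := e
      rw [Pi.add_apply, e']
      exact hpt _ _
    have l2 : (fun ω => ENNReal.ofReal (-(x : Ω →ₘ[P] ℝ) ω)) ≤ᵐ[P]
        (fun ω => ENNReal.ofReal (-(y : Ω →ₘ[P] ℝ) ω)) +
          fun ω => ‖((x - y : condLp m P p) : Ω →ₘ[P] ℝ) ω‖ₑ := by
      filter_upwards [hxy] with ω e
      have e' : ((x - y : condLp m P p) : Ω →ₘ[P] ℝ) ω =
        (x : Ω →ₘ[P] ℝ) ω - (y : Ω →ₘ[P] ℝ) ω := e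
      rw [Pi.add_apply, e', ← enorm_neg, show -((x : Ω →ₘ[P] ℝ) ω - (y : Ω →ₘ[P] ℝ) ω) =
        -(x : Ω →ₘ[P] ℝ) ω - -(y : Ω →ₘ[P] ℝ) ω by ring]
      exact hpt _ _
    filter_upwards [condLExp_mono (mΩ := m) l1, condLExp_mono (mΩ := m) l2,
      condLExp_add_right (mΩ := m) (P := P)
        (fun ω => ENNReal.ofReal ((y : Ω →ₘ[P] ℝ) ω)) hz.aemeasurable,
      condLExp_add_right (mΩ := m) (P := P)
        (fun ω => ENNReal.ofReal (-(y : Ω →ₘ[P] ℝ) ω)) hz.aemeasurable,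
      condLExp_ofReal_lt_top hm hp y, condLExp_enorm_lt_top hm hp (x - y)]
      with ω e1 e2 e3 e4 e5 e6
    rw [e3, Pi.add_apply] at e1
    rw [e4, Pi.add_apply] at e2
    rw [← ENNReal.toReal_add e5.1.ne e6.ne, ← ENNReal.toReal_add e5.2.ne e6.ne]
    exact ⟨ENNReal.toReal_mono (ENNReal.add_lt_top.2 ⟨e5.1, e6⟩).ne e1,
      ENNReal.toReal_mono (ENNReal.add_lt_top.2 ⟨e5.2, e6⟩).ne e2⟩
  have hsymm : condLExp m P (fun ω => ‖((y - x : condLp m P p) : Ω →ₘ[P] ℝ) ω‖ₑ) =ᵐ[P]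
      condLExp m P (fun ω => ‖((x - y : condLp m P p) : Ω →ₘ[P] ℝ) ω‖ₑ) := by
    refine condLExp_congr_ae ?_
    filter_upwards [AEEqFun.coeFn_sub (x : Ω →ₘ[P] ℝ) y, AEEqFun.coeFn_sub (y : Ω →ₘ[P] ℝ) x]
      with ω e1 e2
    have e1' : ((x - y : condLp m P p) : Ω →ₘ[P] ℝ) ω =
        (x : Ω →ₘ[P] ℝ) ω - (y : Ω →ₘ[P] ℝ) ω := e1
    have e2' : ((y - x : condLp m P p) : Ω →ₘ[P] ℝ) ω =
        (y : Ω →ₘ[P] ℝ) ω - (x : Ω →ₘ[P] ℝ) ω := e2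
    rw [e1', e2', ← enorm_neg, neg_sub]
  filter_upwards [hsub x y, hsub y x, hsymm, coeFn_condE hm (x : Ω →ₘ[P] ℝ),
    coeFn_condE hm (y : Ω →ₘ[P] ℝ)] with ω e1 e2 e3 e4 e5
  rw [e3] at e2
  rw [e4, e5, abs_le]
  constructor <;> linarith [e1.1, e1.2, e2.1, e2.2]

end Basic

/-! ### Sequential closedness of the constraints and of the sublevel sets. -/

section Closedness

variable {Ω : Type*} {m mΩ : MeasurableSpace Ω} {P : Measure Ω} {p : ℝ≥0}

/-- Almost sure convergence to zero of the `L⁰`-norms `|||y k - x|||_p`. -/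
def CondTendsto (y : ℕ → condLp m P p) (x : condLp m P p) : Prop :=
  ∀ᵐ ω ∂P, Tendsto (fun k => condPow m P p ((y k - x : condLp m P p) : Ω →ₘ[P] ℝ) ω) atTop (𝓝 0)

/-- A set closed under convergence in the sense of `CondTendsto`. -/
def IsCondSeqClosed (S : Set (condLp m P p)) : Prop :=
  ∀ (y : ℕ → condLp m P p) (x : condLp m P p), (∀ k, y k ∈ S) → CondTendsto y x → x ∈ S

/-- Convexity with weights in `L⁰(ℱ)`. -/
def IsL0Convex (S : Set (condLp m P p)) : Prop :=
  ∀ x ∈ S, ∀ y ∈ S, ∀ ξ : L0 m P, (0 : Ω →ₘ[P] ℝ) ≤ ξ → (ξ : Ω →ₘ[P] ℝ) ≤ 1 →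
    ξ • x + (1 - ξ) • y ∈ S

/-- On a probability space a.s. convergence of the norms implies convergence in probability, which
is what the `(ε, λ)`-neighbourhoods test. -/
theorem CondTendsto.exists_mem_of_isOpen [IsProbabilityMeasure P] (hm : m ≤ mΩ) (hp : 0 < p)
    {y : ℕ → condLp m P p} {x : condLp m P p} (h : CondTendsto y x) {U : Set (condLp m P p)}
    (hU : IsOpen[epsTopology (condNorm (p := p) hm)] U) (hx : x ∈ U) : ∃ k, y k ∈ U := by
  obtain ⟨ε, l, hε, hl, hl1, hUx⟩ := hU x hx
  have hp' : 0 < (p : ℝ) := by exact_mod_cast hp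
  have hlim : ∀ᵐ ω ∂P, Tendsto
      (fun k => (condNorm hm (y k - x) : Ω →ₘ[P] ℝ) ω) atTop (𝓝 0) := by
    filter_upwards [h, ae_all_iff.2 fun k => coeFn_condNorm hm (y k - x)] with ω h1 h2
    simp only [h2]
    have h3 := (ENNReal.tendsto_toReal ENNReal.zero_ne_top).comp h1
    have h4 := h3.rpow_const (p := 1 / (p : ℝ)) (Or.inr (by positivity))
    simpa [Real.zero_rpow hp'.ne', hp'.ne'] using h4
  have hmeas := tendstoInMeasure_of_tendsto_ae (fun k => (condNorm hm (y k - x) :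
    Ω →ₘ[P] ℝ).aestronglyMeasurable) hlim
  rw [tendstoInMeasure_iff_norm] at hmeas
  obtain ⟨k, hk⟩ := ((hmeas ε hε).eventually (gt_mem_nhds (ENNReal.ofReal_pos.2 hl))).exists
  refine ⟨k, hUx _ (ENNReal.sub_lt_of_lt_add (by simpa using hl1.le) ?_)⟩
  have hcover : (1 : ℝ≥0∞) ≤ P {ω | (condNorm hm (y k - x) : Ω →ₘ[P] ℝ) ω < ε} +
      P {ω | ε ≤ ‖(condNorm hm (y k - x) : Ω →ₘ[P] ℝ) ω - 0‖} := by
    rw [← measure_univ (μ := P)]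
    refine (measure_mono fun ω _ => ?_).trans (measure_union_le _ _)
    rcases lt_or_ge ((condNorm hm (y k - x) : Ω →ₘ[P] ℝ) ω) ε with h | h
    · exact Or.inl h
    · refine Or.inr (h.trans ?_)
      simpa using le_abs_self _
  exact hcover.trans_lt (ENNReal.add_lt_add_left (measure_ne_top _ _) hk)

theorem isCondSeqClosed_of_isClosed_epsTopology [IsProbabilityMeasure P] (hm : m ≤ mΩ)
    (hp : 0 < p) {S : Set (condLp m P p)}
    (hS : IsClosed[epsTopology (condNorm (p := p) hm)] S) : IsCondSeqClosed S := by
  intro y x hy hyx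
  by_contra hx
  obtain ⟨k, hk⟩ := hyx.exists_mem_of_isOpen hm hp (U := Sᶜ)
    ((@isOpen_compl_iff _ _ (epsTopology (condNorm (p := p) hm))).2 hS) hx
  exact hk (hy k)

/-- If `c ≠ a`, then `|a - c| ≥ 1 / (n + 1)` with some probability `q > 0`, so the neighbourhood of
`c` with `ε = 1 / (n + 1)` and `λ = q / 2` misses `a`. This is what makes the constraint `π x = 1`
closed. -/
theorem isOpen_compl_singleton_epsTopology_absL0 [IsProbabilityMeasure P] (a : L0 m P) :
    IsOpen[epsTopology (absL0 (m := m) (P := P))] {a}ᶜ := by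
  intro c hc
  set f : Ω → ℝ := ⇑((absL0 (a - c) : L0 m P) : Ω →ₘ[P] ℝ) with hf
  have hfabs : f =ᵐ[P] fun ω => |(a : Ω →ₘ[P] ℝ) ω - (c : Ω →ₘ[P] ℝ) ω| := by
    filter_upwards [AEEqFun.coeFn_abs ((a : Ω →ₘ[P] ℝ) - (c : Ω →ₘ[P] ℝ)),
      AEEqFun.coeFn_sub (a : Ω →ₘ[P] ℝ) (c : Ω →ₘ[P] ℝ)] with ω h1 h2
    refine Eq.trans h1 ?_
    rw [h2]
    rfl
  have hpos : ∃ n : ℕ, P {ω | 1 / ((n : ℝ) + 1) ≤ f ω} ≠ 0 := by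
    by_contra! hcon
    refine hc (Subtype.ext (AEEqFun.ext ?_) : c = a)
    have hn : ∀ᵐ ω ∂P, ∀ n : ℕ, ¬ 1 / ((n : ℝ) + 1) ≤ f ω :=
      ae_all_iff.2 fun n => by simpa [ae_iff] using hcon n
    filter_upwards [hn, hfabs] with ω h1 h2
    by_contra hne
    have h3 : 0 < f ω := by
      rw [h2]
      exact abs_pos.2 (sub_ne_zero.2 (Ne.symm hne))
    obtain ⟨n, hn⟩ := exists_nat_one_div_lt h3
    exact h1 n hn.le
  obtain ⟨n, hn⟩ := hpos
  set q := (P {ω | 1 / ((n : ℝ) + 1) ≤ f ω}).toReal with hq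
  have hqpos : 0 < q := ENNReal.toReal_pos hn (measure_ne_top _ _)
  have hq1 : q ≤ 1 := by
    have := ENNReal.toReal_mono ENNReal.one_ne_top
      (prob_le_one (μ := P) (s := {ω | 1 / ((n : ℝ) + 1) ≤ f ω}))
    rwa [ENNReal.toReal_one] at this
  refine ⟨1 / ((n : ℝ) + 1), q / 2, Nat.one_div_pos_of_nat, by linarith, by linarith, ?_⟩
  rintro y hy rfl
  have hfm : Measurable f := (absL0 (y - c) : Ω →ₘ[P] ℝ).measurable
  have hset : {ω | f ω < 1 / ((n : ℝ) + 1)} = {ω | 1 / ((n : ℝ) + 1) ≤ f ω}ᶜ := by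
    ext ω; simp
  rw [← hf, hset, prob_compl_eq_one_sub (measurableSet_le measurable_const hfm)] at hy
  refine hy.not_ge (tsub_le_tsub_left ?_ _)
  rw [ENNReal.ofReal_le_iff_le_toReal (measure_ne_top _ _)]
  linarith

theorem ENNReal_tendsto_rpow_convexWeight (p : ℝ) :
    Tendsto (fun n : ℕ => ((1 - (1 / ((n : ℝ≥0) + 2)) : ℝ≥0) : ℝ≥0∞) ^ p) atTop (𝓝 1) := by
  have h0 : Tendsto (fun n : ℕ => (1 / ((n : ℝ≥0) + 2) : ℝ≥0)) atTop (𝓝 0) := by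
    have := (tendsto_one_div_add_atTop_nhds_zero_nat (𝕜 := ℝ≥0)).comp (tendsto_add_atTop_nat 1)
    refine this.congr fun n => ?_
    simp only [Function.comp_apply]
    push_cast
    rw [add_assoc, one_add_one_eq_two]
  have h1 : Tendsto (fun n : ℕ => (1 - (1 / ((n : ℝ≥0) + 2)) : ℝ≥0)) atTop (𝓝 1) := by
    simpa using (tendsto_const_nhds (x := (1 : ℝ≥0))).sub h0
  have h2 := (ENNReal.continuous_rpow_const (y := p)).continuousAt.tendsto.comp
    (ENNReal.tendsto_coe.2 h1)
  rw [ENNReal.coe_one, ENNReal.one_rpow] at h2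
  exact h2

/-- Split `x = y k + (x - y k)` by `condPow_add_le` with weights `1 - t n` and `t n`. Letting `k →
∞` removes the second term, and then `n → ∞` removes the factor `(1 - t n) ^ (1 - p)`. -/
theorem isCondSeqClosed_condPow_le (hp : 1 ≤ p) {R : Ω → ℝ≥0∞} (hR : ∀ᵐ ω ∂P, R ω < ∞) :
    IsCondSeqClosed {x : condLp m P p | ∀ᵐ ω ∂P, condPow m P p x ω ≤ R ω} := by
  intro y x hy hyx
  -- The shift by `2` keeps `1 - t n` nonzero also at `n = 0`.
  set t : ℕ → ℝ≥0 := fun n => 1 / ((n : ℝ≥0) + 2) with ht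
  have ht1 : ∀ n, t n < 1 := fun n => by
    rw [ht]
    refine (div_lt_one (by positivity)).2 ?_
    have : (0 : ℝ≥0) ≤ n := zero_le
    calc (1 : ℝ≥0) < 2 := one_lt_two
      _ ≤ n + 2 := le_add_self
  have ht0 : ∀ n, t n ≠ 0 := fun n => by
    have : 0 < t n := by simp only [ht]; positivity
    exact this.ne'
  have hbound : ∀ᵐ ω ∂P, ∀ n k : ℕ, condPow m P p x ω ≤
      ((1 - t n : ℝ≥0) : ℝ≥0∞) ^ (1 - p : ℝ) * condPow m P p (y k) ω +
        (t n : ℝ≥0∞) ^ (1 - p : ℝ) *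
          condPow m P p ((y k - x : condLp m P p) : Ω →ₘ[P] ℝ) ω := by
    refine ae_all_iff.2 fun n => ae_all_iff.2 fun k => ?_
    have hsymm : condPow m P p ((x - y k : condLp m P p) : Ω →ₘ[P] ℝ) =ᵐ[P]
        condPow m P p ((y k - x : condLp m P p) : Ω →ₘ[P] ℝ) := by
      refine condLExp_congr_ae ?_
      filter_upwards [AEEqFun.coeFn_neg ((y k - x : condLp m P p) : Ω →ₘ[P] ℝ)] with ω e
      have e' : ((x - y k : condLp m P p) : Ω →ₘ[P] ℝ) ω =
          -((y k - x : condLp m P p) : Ω →ₘ[P] ℝ) ω := by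
        rw [← neg_sub (y k) x]
        exact e
      rw [e', enorm_neg]
    filter_upwards [condPow_add_le (m := m) hp (tsub_pos_of_lt (ht1 n)).ne' (ht0 n)
      (tsub_add_cancel_of_le (ht1 n).le) (y k : Ω →ₘ[P] ℝ)
      ((x - y k : condLp m P p) : Ω →ₘ[P] ℝ), hsymm] with ω e1 e2
    rw [e2] at e1
    have hxy : (y k : Ω →ₘ[P] ℝ) + ((x - y k : condLp m P p) : Ω →ₘ[P] ℝ) = x := by
      rw [Submodule.coe_sub, add_sub_cancel]
    rwa [hxy] at e1
  have hy' : ∀ᵐ ω ∂P, ∀ k, condPow m P p (y k) ω ≤ R ω := ae_all_iff.2 hy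
  change ∀ᵐ ω ∂P, condPow m P p x ω ≤ R ω
  filter_upwards [hbound, hy', hyx, hR] with ω h1 h2 h3 h4
  have hn : ∀ n, condPow m P p x ω ≤ ((1 - t n : ℝ≥0) : ℝ≥0∞) ^ (1 - p : ℝ) * R ω := by
    intro n
    have hc : (t n : ℝ≥0∞) ^ (1 - p : ℝ) ≠ ∞ :=
      ENNReal.rpow_ne_top_of_ne_zero (by exact_mod_cast ht0 n) ENNReal.coe_ne_top
    have hlim := (tendsto_const_nhds (x := ((1 - t n : ℝ≥0) : ℝ≥0∞) ^ (1 - p : ℝ) * R ω)).add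
      (ENNReal.Tendsto.const_mul h3 (Or.inr hc))
    rw [mul_zero, add_zero] at hlim
    refine ge_of_tendsto' hlim fun k => (h1 n k).trans ?_
    gcongr
    exact h2 k
  have hlim := ENNReal.Tendsto.mul_const (ENNReal_tendsto_rpow_convexWeight (1 - p : ℝ))
    (Or.inr h4.ne)
  rw [one_mul] at hlim
  exact ge_of_tendsto' hlim hn

theorem isCondSeqClosed_condE_eq [IsProbabilityMeasure P] (hm : m ≤ mΩ) (hp : 1 ≤ p)
    (w : L0 m P) : IsCondSeqClosed {x : condLp m P p | condE hm (x : Ω →ₘ[P] ℝ) = w} := by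
  intro y x hy hyx
  -- Taking `δ = 1 / (n + 1)` keeps the family of a.s. statements countable. The limit in `k` is
  -- taken at fixed `δ`, which is then made small.
  have hδ : ∀ᵐ ω ∂P, ∀ n k : ℕ,
      condLExp m P (fun ω => ‖((y k - x : condLp m P p) : Ω →ₘ[P] ℝ) ω‖ₑ) ω ≤
        ((1 / ((n : ℝ≥0) + 1) : ℝ≥0) : ℝ≥0∞) +
          ((1 / ((n : ℝ≥0) + 1) : ℝ≥0) : ℝ≥0∞) ^ (1 - p : ℝ) *
            condPow m P p ((y k - x : condLp m P p) : Ω →ₘ[P] ℝ) ω :=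
    ae_all_iff.2 fun n => ae_all_iff.2 fun k => condLExp_enorm_le hm hp (by positivity) _
  refine Subtype.ext (AEEqFun.ext ?_)
  filter_upwards [hyx, hδ, ae_all_iff.2 fun k => abs_condE_sub_le hm hp (y k) x]
    with ω h1 h2 h3
  have hz : Tendsto (fun k => condLExp m P
      (fun ω => ‖((y k - x : condLp m P p) : Ω →ₘ[P] ℝ) ω‖ₑ) ω) atTop (𝓝 0) := by
    rw [ENNReal.tendsto_nhds_zero]
    intro ε hε
    have hlim0 : Tendsto (fun n : ℕ => ((1 / ((n : ℝ≥0) + 1) : ℝ≥0) : ℝ≥0∞)) atTop (𝓝 0) :=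
      ENNReal.tendsto_coe.2 (tendsto_one_div_add_atTop_nhds_zero_nat (𝕜 := ℝ≥0))
    obtain ⟨n, hn⟩ := (hlim0.eventually (gt_mem_nhds hε)).exists
    have hc : ((1 / ((n : ℝ≥0) + 1) : ℝ≥0) : ℝ≥0∞) ^ (1 - p : ℝ) ≠ ∞ :=
      ENNReal.rpow_ne_top_of_ne_zero (ENNReal.coe_ne_zero.2 (by positivity)) ENNReal.coe_ne_top
    have hlim := (tendsto_const_nhds (x := ((1 / ((n : ℝ≥0) + 1) : ℝ≥0) : ℝ≥0∞))).add
      (ENNReal.Tendsto.const_mul h1 (Or.inr hc))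
    rw [mul_zero, add_zero] at hlim
    filter_upwards [hlim.eventually (gt_mem_nhds hn)] with k hk
    exact (h2 n k).trans hk.le
  have hz' := ((ENNReal.tendsto_toReal ENNReal.zero_ne_top).comp hz).const_mul 2
  simp only [ENNReal.toReal_zero, mul_zero] at hz'
  have hle : |(w : Ω →ₘ[P] ℝ) ω - (condE hm (x : Ω →ₘ[P] ℝ) : Ω →ₘ[P] ℝ) ω| ≤ 0 := by
    refine ge_of_tendsto' hz' fun k => ?_
    have := h3 k
    rwa [show condE hm (y k : Ω →ₘ[P] ℝ) = w from hy k] at this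
  exact (sub_eq_zero.1 (abs_nonpos_iff.1 hle)).symm

/-- Concatenation of a sequence along a random index. -/
theorem exists_concatenation (hm : m ≤ mΩ) (y : ℕ → condLp m P p) {N : Ω → ℕ}
    (hN : Measurable[m] N) :
    ∃ z : condLp m P p, (∀ᵐ ω ∂P, (z : Ω →ₘ[P] ℝ) ω = (y (N ω) : Ω →ₘ[P] ℝ) ω) := by
  have hmeas : Measurable fun ω => (y (N ω) : Ω →ₘ[P] ℝ) ω := by
    have h1 : Measurable fun q : ℕ × Ω => (y q.1 : Ω →ₘ[P] ℝ) q.2 :=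
      measurable_from_prod_countable_right fun n => (y n : Ω →ₘ[P] ℝ).measurable
    exact h1.comp ((hN.mono hm le_rfl).prodMk measurable_id)
  set z : Ω →ₘ[P] ℝ := AEEqFun.mk _ hmeas.aestronglyMeasurable with hz
  have hzy : ∀ᵐ ω ∂P, z ω = (y (N ω) : Ω →ₘ[P] ℝ) ω := AEEqFun.coeFn_mk _ _
  refine ⟨⟨z, ?_⟩, hzy⟩
  change ∀ᵐ ω ∂P, condPow m P p z ω < ∞
  -- On `{N = n}`, which lies in `ℱ`, locality gives `z` the finite conditional moment of `y n`.
  have hloc : ∀ᵐ ω ∂P, ∀ n, ω ∈ N ⁻¹' {n} →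
      condPow m P p z ω = condPow m P p (y n) ω := by
    refine ae_all_iff.2 fun n => condLExp_congr_on (hN (measurableSet_singleton n))
      (measurable_enorm_rpow p _).aemeasurable (measurable_enorm_rpow p _).aemeasurable ?_
    filter_upwards [hzy] with ω h hω
    rw [h, show N ω = n from hω]
  have hfin : ∀ᵐ ω ∂P, ∀ n, condPow m P p (y n) ω < ∞ := ae_all_iff.2 fun n => (y n).2
  filter_upwards [hloc, hfin] with ω h1 h2
  rw [h1 (N ω) rfl]
  exact h2 _

theorem condPow_congr_on {A : Set Ω} (hA : MeasurableSet[m] A) {x y : Ω →ₘ[P] ℝ}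
    (h : ∀ᵐ ω ∂P, ω ∈ A → x ω = y ω) :
    ∀ᵐ ω ∂P, ω ∈ A → condPow m P p x ω = condPow m P p y ω := by
  refine condLExp_congr_on hA (measurable_enorm_rpow p _).aemeasurable
    (measurable_enorm_rpow p _).aemeasurable ?_
  filter_upwards [h] with ω h1 h2
  rw [h1 h2]

namespace IsCondConvexRiskMeasure

variable {hm : m ≤ mΩ} {ρ : condLp m P p → L0bar m P}

/-- Convexity with an indicator weight: at each `ω` one coefficient is `1` and the other `0`, and `0
* (+∞) = 0` removes the unwanted term. -/
theorem paste_le (hρ : IsCondConvexRiskMeasure hm ρ) {A : Set Ω} (hA : MeasurableSet[m] A)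
    (x y : condLp m P p) :
    ∀ᵐ ω ∂P,
      (ω ∈ A → (ρ (indL0 P hm hA • x + (1 - indL0 P hm hA) • y)).1 ω ≤ (ρ x).1 ω) ∧
      (ω ∉ A → (ρ (indL0 P hm hA • x + (1 - indL0 P hm hA) • y)).1 ω ≤ (ρ y).1 ω) := by
  filter_upwards [hρ.convex x y (indL0 P hm hA) (indL0_nonneg hm hA) (indL0_le_one hm hA),
    coeFn_indL0 (P := P) hm hA] with ω h1 h2
  rw [h2] at h1
  constructor <;> intro h <;> simpa [h] using h1

/-- Risk measures are local. -/
theorem congr_on (hρ : IsCondConvexRiskMeasure hm ρ) {A : Set Ω} (hA : MeasurableSet[m] A)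
    {x y : condLp m P p} (h : ∀ᵐ ω ∂P, ω ∈ A → (x : Ω →ₘ[P] ℝ) ω = (y : Ω →ₘ[P] ℝ) ω) :
    ∀ᵐ ω ∂P, ω ∈ A → (ρ x).1 ω = (ρ y).1 ω := by
  have key : ∀ x y : condLp m P p,
      (∀ᵐ ω ∂P, ω ∈ A → (x : Ω →ₘ[P] ℝ) ω = (y : Ω →ₘ[P] ℝ) ω) →
      ∀ᵐ ω ∂P, ω ∈ A → (ρ y).1 ω ≤ (ρ x).1 ω := by
    intro x y h
    -- Since `x = y` on `A`, replacing `y` by `x` there changes nothing.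
    have hxy : indL0 P hm hA • x + (1 - indL0 P hm hA) • y = y := by
      refine Subtype.ext (AEEqFun.ext ?_)
      filter_upwards [coeFn_paste hm hA x y, h] with ω h1 h2
      by_cases hω : ω ∈ A
      · rw [h1.1 hω, h2 hω]
      · rw [h1.2 hω]
    have := hρ.paste_le hA x y
    rw [hxy] at this
    exact this.mono fun ω h1 h2 => h1.1 h2
  filter_upwards [key x y h, key y x (h.mono fun ω h1 h2 => (h1 h2).symm)] with ω h1 h2 hω
  exact le_antisymm (h2 hω) (h1 hω)

/-- A ball of random radius `ε` need not contain any single `y k`, as the index needed depends on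
`ω`. The concatenation of the `y k` along the first index with `|||y k - x|||_p ≤ ε` does lie in the
ball, and by locality it stays in the sublevel set. -/
theorem isCondSeqClosed_le_coe (hρ : IsCondConvexRiskMeasure hm ρ) (hp : 0 < p) (s : L0 m P) :
    IsCondSeqClosed {x | ∀ᵐ ω ∂P, (ρ x).1 ω ≤ (((s : Ω →ₘ[P] ℝ) ω : ℝ) : EReal)} := by
  classical
  intro y x hy hyx
  by_contra hx
  obtain ⟨ε, hε, hball⟩ := (@isOpen_compl_iff _ _ (locTopology (condNorm (p := p) hm))).2
    (hρ.lsc s) x hx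
  obtain ⟨g, hg, hεg⟩ := L0_exists_measurable ε
  set B : ℕ → Set Ω := fun k => {ω | condPow m P p ((y k - x : condLp m P p) : Ω →ₘ[P] ℝ) ω ≤
    ENNReal.ofReal (g ω) ^ (p : ℝ)} with hB
  have hBm : ∀ k, MeasurableSet[m] (B k) := fun k =>
    measurableSet_le (measurable_condLExp m P _) (hg.ennreal_ofReal.pow_const _)
  -- The second alternative makes the random index total; it occurs only on a null set, by
  -- convergence.
  have hex : ∀ ω, ∃ k, ω ∈ B k ∨ ω ∉ ⋃ j, B j := fun ω => by
    by_cases h : ω ∈ ⋃ j, B j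
    · obtain ⟨j, hj⟩ := Set.mem_iUnion.1 h
      exact ⟨j, Or.inl hj⟩
    · exact ⟨0, Or.inr h⟩
  have hN : Measurable[m] fun ω => Nat.find (hex ω) :=
    @measurable_find _ m _ _ hex fun k =>
      (hBm k).union (MeasurableSet.iUnion (m := m) hBm).compl
  obtain ⟨z, hz⟩ := exists_concatenation hm y hN
  have hzk : ∀ k, ∀ᵐ ω ∂P, ω ∈ (fun ω => Nat.find (hex ω)) ⁻¹' {k} →
      (z : Ω →ₘ[P] ℝ) ω = (y k : Ω →ₘ[P] ℝ) ω := fun k => by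
    filter_upwards [hz] with ω h hω
    rw [h, show Nat.find (hex ω) = k from hω]
  have hzρ : z ∈ {x | ∀ᵐ ω ∂P, (ρ x).1 ω ≤ (((s : Ω →ₘ[P] ℝ) ω : ℝ) : EReal)} := by
    have h1 := ae_all_iff.2 fun k => hρ.congr_on (hN (measurableSet_singleton k)) (hzk k)
    have h2 : ∀ᵐ ω ∂P, ∀ k, (ρ (y k)).1 ω ≤ (((s : Ω →ₘ[P] ℝ) ω : ℝ) : EReal) :=
      ae_all_iff.2 hy
    change ∀ᵐ ω ∂P, (ρ z).1 ω ≤ (((s : Ω →ₘ[P] ℝ) ω : ℝ) : EReal)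
    filter_upwards [h1, h2] with ω e1 e2
    rw [e1 _ rfl]
    exact e2 _
  refine hball z ?_ hzρ
  rw [condNorm_le_iff hm hp _ hε]
  have h1 : ∀ᵐ ω ∂P, ∀ k, ω ∈ (fun ω => Nat.find (hex ω)) ⁻¹' {k} →
      condPow m P p ((z - x : condLp m P p) : Ω →ₘ[P] ℝ) ω =
        condPow m P p ((y k - x : condLp m P p) : Ω →ₘ[P] ℝ) ω := by
    refine ae_all_iff.2 fun k => condPow_congr_on (hN (measurableSet_singleton k)) ?_
    filter_upwards [hzk k, AEEqFun.coeFn_sub (z : Ω →ₘ[P] ℝ) x,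
      AEEqFun.coeFn_sub (y k : Ω →ₘ[P] ℝ) x] with ω e1 e2 e3 hω
    refine e2.trans (Eq.trans ?_ e3.symm)
    rw [Pi.sub_apply, Pi.sub_apply, e1 hω]
  filter_upwards [h1, hyx, hε, hεg] with ω e1 e2 e3 e4
  rw [e1 _ rfl, e4]
  rw [e4] at e3
  have hpos : 0 < ENNReal.ofReal (g ω) ^ (p : ℝ) :=
    ENNReal.rpow_pos (ENNReal.ofReal_pos.2 e3) ENNReal.ofReal_ne_top
  obtain ⟨k, hk⟩ := (e2.eventually (gt_mem_nhds hpos)).exists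
  rcases Nat.find_spec (hex ω) with h | h
  · exact h
  · exact absurd (Set.mem_iUnion.2 ⟨k, hk.le⟩) h

/-- Reduction to a real threshold. Where `t = +∞` there is no constraint, so there the sequence and
its limit are replaced by some `v` with `ρ v < +∞`, and the threshold by `ρ v`. -/
theorem isCondSeqClosed_le (hρ : IsCondConvexRiskMeasure hm ρ) (hp : 0 < p) (t : L0bar m P) :
    IsCondSeqClosed {x | ρ x ≤ t} := by
  intro y x hy hyx
  obtain ⟨v, hv⟩ := hρ.exists_ne_top
  obtain ⟨T, hT, htT⟩ := L0bar_exists_measurable t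
  obtain ⟨V, hV, hvV⟩ := L0bar_exists_measurable (ρ v)
  set A : Set Ω := {ω | T ω < ⊤} with hAdef
  have hA : MeasurableSet[m] A := hT measurableSet_Iio
  have hs : Measurable[m] fun ω => if ω ∈ A then (T ω).toReal else (V ω).toReal :=
    Measurable.ite hA hT.ereal_toReal hV.ereal_toReal
  have hcl := hρ.isCondSeqClosed_le_coe hp (mkL0 P hm _ hs)
    (fun k => indL0 P hm hA • y k + (1 - indL0 P hm hA) • v)
    (indL0 P hm hA • x + (1 - indL0 P hm hA) • v)
  have hyt : ∀ k, ∀ᵐ ω ∂P, (ρ (y k)).1 ω ≤ t.1 ω := fun k => AEEqFun.coeFn_le.2 (hy k)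
  have h1 : ∀ᵐ ω ∂P, (ρ (indL0 P hm hA • x + (1 - indL0 P hm hA) • v)).1 ω ≤
      (((mkL0 P hm _ hs : Ω →ₘ[P] ℝ) ω : ℝ) : EReal) := by
    refine hcl (fun k => ?_) ?_
    · change ∀ᵐ ω ∂P, _
      filter_upwards [hρ.paste_le hA (y k) v, coeFn_mkL0 (P := P) hm hs, hyt k, htT, hvV, hv]
        with ω e1 e2 e3 e4 e5 e6
      rw [e2]
      by_cases hω : ω ∈ A
      · rw [if_pos hω]
        rw [e4] at e3
        exact ((e1.1 hω).trans e3).trans (EReal.le_coe_toReal (ne_of_lt hω))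
      · rw [if_neg hω]
        refine (e1.2 hω).trans ?_
        rw [e5] at e6 ⊢
        exact EReal.le_coe_toReal e6.ne
    · have hle : ∀ᵐ ω ∂P, ∀ k, condPow m P p
          ((indL0 P hm hA • y k + (1 - indL0 P hm hA) • v -
            (indL0 P hm hA • x + (1 - indL0 P hm hA) • v) : condLp m P p) : Ω →ₘ[P] ℝ) ω ≤
          condPow m P p ((y k - x : condLp m P p) : Ω →ₘ[P] ℝ) ω := by
        refine ae_all_iff.2 fun k => condLExp_mono (mΩ := m) ?_
        filter_upwards [coeFn_paste hm hA (y k) v, coeFn_paste hm hA x v,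
          AEEqFun.coeFn_sub
            ((indL0 P hm hA • y k + (1 - indL0 P hm hA) • v : condLp m P p) : Ω →ₘ[P] ℝ)
            ((indL0 P hm hA • x + (1 - indL0 P hm hA) • v : condLp m P p) : Ω →ₘ[P] ℝ),
          AEEqFun.coeFn_sub (y k : Ω →ₘ[P] ℝ) x] with ω e1 e2 e3 e4
        refine ENNReal.rpow_le_rpow ?_ p.coe_nonneg
        rw [Submodule.coe_sub, Submodule.coe_sub, e3, e4, Pi.sub_apply, Pi.sub_apply]
        by_cases hω : ω ∈ A
        · rw [e1.1 hω, e2.1 hω]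
        · rw [e1.2 hω, e2.2 hω, sub_self, enorm_zero]
          exact zero_le
      filter_upwards [hle, hyx] with ω e1 e2
      exact tendsto_of_tendsto_of_tendsto_of_le_of_le tendsto_const_nhds e2
        (fun k => zero_le) e1
  have h2 := hρ.congr_on hA (x := indL0 P hm hA • x + (1 - indL0 P hm hA) • v) (y := x)
    ((coeFn_paste hm hA x v).mono fun ω h => h.1)
  change ρ x ≤ t
  refine AEEqFun.coeFn_le.1 ?_
  -- The element `y 0` serves to exclude `t = -∞`, since `-∞ < ρ (y 0) ≤ t`; only then does `toReal`
  -- recover `t` on `A`.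
  filter_upwards [h1, h2, coeFn_mkL0 (P := P) hm hs, htT, hyt 0, hρ.ne_bot (y 0)]
    with ω e1 e2 e3 e4 e5 e6
  rw [e4] at e5 ⊢
  by_cases hω : ω ∈ A
  · rw [e2 hω, e3, if_pos hω, EReal.coe_toReal (ne_of_lt hω) (e6.trans_le e5).ne'] at e1
    exact e1
  · rw [show T ω = ⊤ from not_lt_top_iff.1 hω]
    exact le_top

end IsCondConvexRiskMeasure

end Closedness

/-! ### Nested intersections and attainment of the minimum. -/

section Minimization

variable {Ω : Type*} {m mΩ : MeasurableSpace Ω} {P : Measure Ω} {p : ℝ≥0}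

/-- With integrals below `2⁻¹ ^ n` the selected functions have an a.s. finite sum, hence tend to
`0`. The bound `n ≤ φ n` is all that decreasing sets require of the selection. -/
theorem exists_subseq_ae_tendsto_zero {f : ℕ → Ω → ℝ≥0∞} (hf : ∀ n, AEMeasurable (f n) P)
    (h : Tendsto (fun n => ∫⁻ ω, f n ω ∂P) atTop (𝓝 0)) :
    ∃ φ : ℕ → ℕ, (∀ n, n ≤ φ n) ∧ ∀ᵐ ω ∂P, Tendsto (fun n => f (φ n) ω) atTop (𝓝 0) := by
  have hex : ∀ n : ℕ, ∃ k, n ≤ k ∧ ∫⁻ ω, f k ω ∂P < 2⁻¹ ^ n := by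
    intro n
    have hpos : (0 : ℝ≥0∞) < 2⁻¹ ^ n := ENNReal.pow_pos (by simp) n
    obtain ⟨k, hk⟩ := ((h.eventually (gt_mem_nhds hpos)).and (eventually_ge_atTop n)).exists
    exact ⟨k, hk.2, hk.1⟩
  choose φ hφ hφ' using hex
  refine ⟨φ, hφ, ?_⟩
  have hsum : ∫⁻ ω, ∑' n, f (φ n) ω ∂P ≠ ∞ := by
    rw [lintegral_tsum fun n => hf _]
    refine ne_top_of_le_ne_top ?_ (ENNReal.tsum_le_tsum fun n => (hφ' n).le)
    rw [ENNReal.tsum_geometric]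
    simp
  filter_upwards [ae_lt_top' (AEMeasurable.tsum fun n => hf _) hsum] with ω hω
  exact ENNReal.tendsto_atTop_zero_of_tsum_ne_top hω.ne

theorem condPow_of_coeFn_eq_mul {g : Ω → ℝ} (hg : Measurable[m] g) {u : Ω → ℝ}
    (hu : AEMeasurable u P) {x : Ω →ₘ[P] ℝ} (hx : x =ᵐ[P] fun ω => g ω * u ω) :
    condPow m P p x =ᵐ[P] fun ω =>
      ‖g ω‖ₑ ^ (p : ℝ) * condLExp m P (fun ω => ‖u ω‖ₑ ^ (p : ℝ)) ω := by
  refine EventuallyEq.trans (condLExp_congr_ae ?_)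
    (condLExp_mul_left ((measurable_enorm.comp hg).pow_const _) (hu.enorm.pow_const _))
  filter_upwards [hx] with ω h
  simp only [h, enorm_mul, ENNReal.mul_rpow_of_nonneg _ _ p.coe_nonneg]

/-- The tower property applied to `u = x / g`: it links the conditional norm of `x` to the ordinary
`L^p` norm of the rescaled variable. -/
theorem lintegral_enorm_rpow_of_coeFn_eq_mul [IsProbabilityMeasure P] (hm : m ≤ mΩ) {g : Ω → ℝ}
    (hg : Measurable[m] g) {u : Ω → ℝ} (hu : AEMeasurable u P) {x : Ω →ₘ[P] ℝ}
    (hx : x =ᵐ[P] fun ω => g ω * u ω) (hg0 : ∀ᵐ ω ∂P, g ω ≠ 0) :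
    ∫⁻ ω, ‖u ω‖ₑ ^ (p : ℝ) ∂P = ∫⁻ ω, (‖g ω‖ₑ ^ (p : ℝ))⁻¹ * condPow m P p x ω ∂P := by
  rw [← lintegral_condLExp hm P]
  refine lintegral_congr_ae ?_
  filter_upwards [condPow_of_coeFn_eq_mul (p := p) hg hu hx, hg0] with ω h1 h2
  have h0 : ‖g ω‖ₑ ^ (p : ℝ) ≠ 0 :=
    (ENNReal.rpow_pos (enorm_pos.2 h2) enorm_ne_top).ne'
  have ht : ‖g ω‖ₑ ^ (p : ℝ) ≠ ∞ := ENNReal.rpow_ne_top_of_nonneg p.coe_nonneg enorm_ne_top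
  rw [h1, ← mul_assoc, ENNReal.inv_mul_cancel h0 ht, one_mul]

/-- A decreasing sequence of nonempty `L⁰`-convex closed `L⁰`-bounded sets has nonempty
intersection. -/
theorem exists_forall_mem_of_antitone [IsProbabilityMeasure P] (hm : m ≤ mΩ) (hp : 1 < p)
    {r : L0 m P} (hr : IsPos r) {C : ℕ → Set (condLp m P p)} (hanti : Antitone C)
    (hne : ∀ n, (C n).Nonempty) (hconv : ∀ n, IsL0Convex (C n))
    (hclosed : ∀ n, IsCondSeqClosed (C n))
    (hbdd : ∀ x ∈ C 0, ∀ᵐ ω ∂P,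
      condPow m P p x ω ≤ ENNReal.ofReal ((r : Ω →ₘ[P] ℝ) ω) ^ (p : ℝ)) :
    ∃ x, ∀ n, x ∈ C n := by
  have : Fact (1 ≤ (p : ℝ≥0∞)) := ⟨by exact_mod_cast hp.le⟩
  have hp0 : 0 < p := zero_lt_one.trans hp
  have hp0' : (p : ℝ≥0∞) ≠ 0 := by exact_mod_cast hp0.ne'
  obtain ⟨g, hg, hrg⟩ := L0_exists_measurable r
  have hgpos : ∀ᵐ ω ∂P, 0 < g ω := by
    filter_upwards [hr, hrg] with ω h1 h2
    rwa [← h2]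
  have hg0 : ∀ᵐ ω ∂P, g ω ≠ 0 := hgpos.mono fun ω h => h.ne'
  have hgm : Measurable g := hg.mono hm le_rfl
  have hmul : ∀ x : condLp m P p, (x : Ω →ₘ[P] ℝ) =ᵐ[P]
      fun ω => g ω * ((g ω)⁻¹ * (x : Ω →ₘ[P] ℝ) ω) := fun x => by
    filter_upwards [hg0] with ω h
    rw [mul_inv_cancel_left₀ h]
  have hum : ∀ x : condLp m P p, Measurable fun ω => (g ω)⁻¹ * (x : Ω →ₘ[P] ℝ) ω :=
    fun x => hgm.inv.mul (x : Ω →ₘ[P] ℝ).measurable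
  have hnorm : ∀ x ∈ C 0, eLpNorm (fun ω => (g ω)⁻¹ * (x : Ω →ₘ[P] ℝ) ω) p P ≤ 1 := by
    intro x hx
    rw [eLpNorm_eq_lintegral_rpow_enorm_toReal hp0' ENNReal.coe_ne_top, ENNReal.coe_toReal]
    refine ENNReal.rpow_le_one ?_ (by positivity)
    rw [lintegral_enorm_rpow_of_coeFn_eq_mul hm hg (hum x).aemeasurable (hmul x) hg0]
    calc _ ≤ ∫⁻ _, 1 ∂P := by
          refine lintegral_mono_ae ?_
          filter_upwards [hbdd x hx, hrg, hgpos] with ω h1 h2 h3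
          rw [h2, ← Real.enorm_of_nonneg h3.le] at h1
          refine (mul_le_mul_right h1 _).trans (ENNReal.inv_mul_le_one _)
      _ = 1 := by simp
  set D : ℕ → Set (Lp ℝ p P) := fun n =>
    {u | ∃ x ∈ C n, u =ᵐ[P] fun ω => (g ω)⁻¹ * (x : Ω →ₘ[P] ℝ) ω} with hD
  have hDanti : Antitone D := by
    rintro i j hij u ⟨x, hx, hux⟩
    exact ⟨x, hanti hij hx, hux⟩
  obtain ⟨u, hu, l, hl⟩ := Lp_exists_tendsto_of_antitone hp hDanti
    (fun n => by
      obtain ⟨x, hx⟩ := hne n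
      have hmem : MemLp (fun ω => (g ω)⁻¹ * (x : Ω →ₘ[P] ℝ) ω) p P :=
        ⟨(hum x).aestronglyMeasurable,
          (hnorm x (hanti (Nat.zero_le n) hx)).trans_lt ENNReal.one_lt_top⟩
      exact ⟨hmem.toLp, x, hx, hmem.coeFn_toLp⟩)
    (by
      rintro n u ⟨x, hx, hux⟩ v ⟨y, hy, hvy⟩
      -- Only midpoints are needed in `L^p`, so the constant weight `1 / 2` suffices.
      set ξ : L0 m P := mkL0 P hm (fun _ => 1 / 2) measurable_const with hξ
      have hξc : (ξ : Ω →ₘ[P] ℝ) =ᵐ[P] fun _ => 1 / 2 := coeFn_mkL0 hm _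
      refine ⟨ξ • x + (1 - ξ) • y, hconv n x hx y hy ξ ?_ ?_, ?_⟩
      · rw [← AEEqFun.coeFn_le]
        filter_upwards [hξc, AEEqFun.coeFn_zero (α := Ω) (μ := P) (β := ℝ)] with ω h1 h2
        rw [h1, h2]
        norm_num
      · rw [← AEEqFun.coeFn_le]
        filter_upwards [hξc, AEEqFun.coeFn_one (α := Ω) (μ := P) (β := ℝ)] with ω h1 h2
        rw [h1, h2]
        norm_num
      · filter_upwards [Lp.coeFn_smul (1 / 2 : ℝ) (u + v), Lp.coeFn_add u v,
          coeFn_convexComb x y ξ, hξc, hux, hvy] with ω h1 h2 h3 h4 h5 h6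
        rw [h1, Pi.smul_apply, h2, Pi.add_apply, h3, h4, h5, h6, smul_eq_mul]
        ring)
    (R := 1)
    (by
      rintro u ⟨x, hx, hux⟩
      rw [Lp.norm_def, eLpNorm_congr_ae hux]
      exact ENNReal.toReal_le_of_le_ofReal zero_le_one (by simpa using hnorm x hx))
  choose x hxC hux using hu
  -- The limit is scaled back by `g`, the `ℱ`-measurable version of `r`.
  set z : Ω →ₘ[P] ℝ := AEEqFun.mk (fun ω => g ω * l ω)
    (hgm.aestronglyMeasurable.mul (Lp.aestronglyMeasurable l)) with hz
  have hzl : z =ᵐ[P] fun ω => g ω * l ω := AEEqFun.coeFn_mk _ _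
  have hlm : AEMeasurable l P := (Lp.aestronglyMeasurable l).aemeasurable
  have hzmem : z ∈ condLp m P p := by
    change ∀ᵐ ω ∂P, condPow m P p z ω < ∞
    have hfin : ∫⁻ ω, ‖l ω‖ₑ ^ (p : ℝ) ∂P ≠ ∞ := by
      have := lintegral_rpow_enorm_lt_top_of_eLpNorm_lt_top hp0' ENNReal.coe_ne_top
        (Lp.eLpNorm_lt_top l)
      rw [ENNReal.coe_toReal] at this
      exact this.ne
    filter_upwards [condPow_of_coeFn_eq_mul (p := p) hg hlm hzl,
      condLExp_lt_top (mΩ := m) hfin] with ω h1 h2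
    rw [h1]
    exact ENNReal.mul_lt_top (ENNReal.rpow_lt_top_of_nonneg p.coe_nonneg enorm_ne_top) h2
  have hlim : Tendsto (fun n => ∫⁻ ω, (‖g ω‖ₑ ^ (p : ℝ))⁻¹ *
      condPow m P p ((x n - ⟨z, hzmem⟩ : condLp m P p) : Ω →ₘ[P] ℝ) ω ∂P) atTop (𝓝 0) := by
    have h1 : Tendsto (fun n => eLpNorm (u n - l : Ω → ℝ) p P ^ (p : ℝ)) atTop (𝓝 0) := by
      have h2 := (Lp.tendsto_Lp_iff_tendsto_eLpNorm' u l).1 hl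
      have h3 := (ENNReal.continuous_rpow_const (y := (p : ℝ))).continuousAt.tendsto.comp h2
      rwa [ENNReal.zero_rpow_of_pos (by exact_mod_cast hp0)] at h3
    refine h1.congr fun n => ?_
    have hd : ((x n - ⟨z, hzmem⟩ : condLp m P p) : Ω →ₘ[P] ℝ) =ᵐ[P]
        fun ω => g ω * (u n - l : Ω → ℝ) ω := by
      filter_upwards [AEEqFun.coeFn_sub (x n : Ω →ₘ[P] ℝ) z, hux n, hzl, hg0] with ω e1 e2 e3 e4
      refine e1.trans ?_
      rw [Pi.sub_apply, Pi.sub_apply, e2, e3, mul_sub, mul_inv_cancel_left₀ e4]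
    rw [← lintegral_enorm_rpow_of_coeFn_eq_mul hm hg
      ((Lp.aestronglyMeasurable (u n)).sub (Lp.aestronglyMeasurable l)).aemeasurable hd hg0,
      eLpNorm_eq_lintegral_rpow_enorm_toReal hp0' ENNReal.coe_ne_top, ENNReal.coe_toReal,
      ← ENNReal.rpow_mul, one_div, inv_mul_cancel₀ (by exact_mod_cast hp0.ne'), ENNReal.rpow_one]
  obtain ⟨φ, hφ, hφlim⟩ := exists_subseq_ae_tendsto_zero (f := fun n ω =>
    (‖g ω‖ₑ ^ (p : ℝ))⁻¹ *
      condPow m P p ((x n - ⟨z, hzmem⟩ : condLp m P p) : Ω →ₘ[P] ℝ) ω) (fun n =>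
    ((((measurable_enorm.comp hgm).pow_const _).inv).mul
      ((measurable_condLExp m P _).mono hm le_rfl)).aemeasurable) hlim
  -- The shift by `n` puts every term in `C n`, because `φ (k + n) ≥ n` and the sets decrease.
  refine ⟨⟨z, hzmem⟩, fun n => hclosed n (fun k => x (φ (k + n))) _ (fun k => ?_) ?_⟩
  · exact hanti ((Nat.le_add_left n k).trans (hφ _)) (hxC _)
  · filter_upwards [hφlim, hg0] with ω h1 h2
    have h0 : ‖g ω‖ₑ ^ (p : ℝ) ≠ 0 :=
      (ENNReal.rpow_pos (enorm_pos.2 h2) enorm_ne_top).ne'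
    have ht : ‖g ω‖ₑ ^ (p : ℝ) ≠ ∞ := ENNReal.rpow_ne_top_of_nonneg p.coe_nonneg enorm_ne_top
    have h3 := ENNReal.Tendsto.const_mul (h1.comp (tendsto_add_atTop_nat n))
      (Or.inr ht)
    rw [mul_zero] at h3
    refine h3.congr fun k => ?_
    simp only [Function.comp_apply]
    rw [← mul_assoc, ENNReal.mul_inv_cancel h0 ht, one_mul]

theorem IsL0Convex.inter {S T : Set (condLp m P p)} (hS : IsL0Convex S) (hT : IsL0Convex T) :
    IsL0Convex (S ∩ T) := fun x hx y hy ξ h0 h1 =>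
  ⟨hS x hx.1 y hy.1 ξ h0 h1, hT x hx.2 y hy.2 ξ h0 h1⟩

theorem IsCondSeqClosed.inter {S T : Set (condLp m P p)} (hS : IsCondSeqClosed S)
    (hT : IsCondSeqClosed T) : IsCondSeqClosed (S ∩ T) := fun y x hy hyx =>
  ⟨hS y x (fun k => (hy k).1) hyx, hT y x (fun k => (hy k).2) hyx⟩

namespace IsCondConvexRiskMeasure

variable {hm : m ≤ mΩ} {ρ : condLp m P p → L0bar m P}

theorem isL0Convex_le (hρ : IsCondConvexRiskMeasure hm ρ) (t : L0bar m P) :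
    IsL0Convex {x | ρ x ≤ t} := by
  intro x hx y hy ξ h0 h1
  have hx' : ∀ᵐ ω ∂P, (ρ x).1 ω ≤ t.1 ω := AEEqFun.coeFn_le.2 hx
  have hy' : ∀ᵐ ω ∂P, (ρ y).1 ω ≤ t.1 ω := AEEqFun.coeFn_le.2 hy
  refine AEEqFun.coeFn_le.1 ?_
  have hconv := hρ.convex x y ξ h0 h1
  rw [← AEEqFun.coeFn_le] at h0 h1
  filter_upwards [hconv, hx', hy', h0, h1, AEEqFun.coeFn_zero (α := Ω) (μ := P) (β := ℝ),
    AEEqFun.coeFn_one (α := Ω) (μ := P) (β := ℝ)] with ω e1 e2 e3 e4 e5 e6 e7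
  rw [e6] at e4
  rw [e7] at e5
  have h0' : (0 : EReal) ≤ (((ξ : Ω →ₘ[P] ℝ) ω : ℝ) : EReal) := EReal.coe_nonneg.2 e4
  have h1' : (0 : EReal) ≤ ((1 - (ξ : Ω →ₘ[P] ℝ) ω : ℝ) : EReal) :=
    EReal.coe_nonneg.2 (sub_nonneg.2 e5)
  refine e1.trans ((add_le_add (mul_le_mul_of_nonneg_left e2 h0')
    (mul_le_mul_of_nonneg_left e3 h1')).trans_eq ?_)
  rw [← EReal.right_distrib_of_nonneg h0' h1', ← EReal.coe_add, add_sub_cancel, EReal.coe_one,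
    one_mul]

/-- `L⁰`-convex sets are directed downwards with respect to the values of `ρ`. -/
theorem exists_le_le (hρ : IsCondConvexRiskMeasure hm ρ) {S : Set (condLp m P p)}
    (hS : IsL0Convex S) {x y : condLp m P p} (hx : x ∈ S) (hy : y ∈ S) :
    ∃ z ∈ S, ρ z ≤ ρ x ∧ ρ z ≤ ρ y := by
  obtain ⟨X, hX, hxX⟩ := L0bar_exists_measurable (ρ x)
  obtain ⟨Y, hY, hyY⟩ := L0bar_exists_measurable (ρ y)
  -- Pasting `x` where `ρ x ≤ ρ y` with `y` elsewhere brings `ρ` below the pointwise minimum.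
  have hA : MeasurableSet[m] {ω | X ω ≤ Y ω} := measurableSet_le hX hY
  refine ⟨indL0 P hm hA • x + (1 - indL0 P hm hA) • y,
    hS x hx y hy _ (indL0_nonneg hm hA) (indL0_le_one hm hA), AEEqFun.coeFn_le.1 ?_,
    AEEqFun.coeFn_le.1 ?_⟩
  all_goals
    filter_upwards [hρ.paste_le hA x y, hxX, hyY] with ω e1 e2 e3
    by_cases hω : ω ∈ {ω | X ω ≤ Y ω}
  · exact e1.1 hω
  · refine (e1.2 hω).trans ?_
    rw [e2, e3]
    exact (not_le.1 hω).le
  · refine (e1.1 hω).trans ?_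
    rw [e2, e3]
    exact hω
  · exact e1.2 hω

/-- A conditional convex risk measure attains its minimum over nonempty `L⁰`-convex closed
`L⁰`-bounded sets. -/
theorem exists_isMinOn [IsProbabilityMeasure P] (hρ : IsCondConvexRiskMeasure hm ρ) (hp : 1 < p)
    {S : Set (condLp m P p)} (hne : S.Nonempty) (hconv : IsL0Convex S)
    (hclosed : IsCondSeqClosed S) {r : L0 m P} (hr : IsPos r)
    (hbdd : ∀ x ∈ S, ∀ᵐ ω ∂P,
      condPow m P p x ω ≤ ENNReal.ofReal ((r : Ω →ₘ[P] ℝ) ω) ^ (p : ℝ)) :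
    ∃ x₀ ∈ S, ∀ x ∈ S, ρ x₀ ≤ ρ x := by
  -- A strictly decreasing map of `EReal` into `[0, 1]`: expectations are finite even where `ρ =
  -- +∞`, and minimizing `ρ` becomes maximizing `K`.
  set φ : EReal → ℝ≥0∞ := fun a => (1 + a.exp)⁻¹ with hφ
  have hφm : Measurable φ := (EReal.measurable_exp.const_add 1).inv
  have hφle : ∀ a, φ a ≤ 1 := fun a => by simp [hφ]
  have hφanti : Antitone φ := fun a b hab =>
    ENNReal.inv_le_inv.2 (add_le_add_right (EReal.exp_monotone hab) 1)
  have hφinj : Function.Injective φ := by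
    intro a b hab
    have := inv_injective hab
    exact EReal.exp_strictMono.injective ((ENNReal.add_right_inj ENNReal.one_ne_top).1 this)
  set K : condLp m P p → ℝ≥0∞ := fun x => ∫⁻ ω, φ ((ρ x).1 ω) ∂P with hK
  have hK1 : ∀ x, K x ≤ 1 := fun x => by
    calc K x ≤ ∫⁻ _, 1 ∂P := lintegral_mono fun ω => hφle _
      _ = 1 := by simp
  have hKanti : ∀ x y, ρ x ≤ ρ y → K y ≤ K x := fun x y hxy =>
    lintegral_mono_ae ((AEEqFun.coeFn_le.2 hxy).mono fun ω h => hφanti h)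
  set s := sSup (K '' S) with hs
  obtain ⟨v, -, hvlim, hvS⟩ := exists_seq_tendsto_sSup (hne.image K) (OrderTop.bddAbove _)
  choose x hxS hxv using hvS
  -- Directedness makes the finite intersections of sublevel sets nonempty.
  have hfin : ∀ n, ∃ z ∈ S, ∀ i ≤ n, ρ z ≤ ρ (x i) := by
    intro n
    induction n with
    | zero => exact ⟨x 0, hxS 0, fun i hi => by rw [Nat.le_zero.1 hi]⟩
    | succ n ih =>
      obtain ⟨z, hz, hzx⟩ := ih
      obtain ⟨z', hz', h1, h2⟩ := hρ.exists_le_le hconv hz (hxS (n + 1))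
      refine ⟨z', hz', fun i hi => ?_⟩
      rcases Nat.of_le_succ hi with h | rfl
      · exact h1.trans (hzx i h)
      · exact h2
  choose z hzS hzx using hfin
  obtain ⟨x₀, hx₀⟩ := exists_forall_mem_of_antitone hm hp hr
    (C := fun n => S ∩ ⋂ i ∈ Set.Iic n, {y | ρ y ≤ ρ (x i)})
    (fun i j hij y hy => ⟨hy.1, Set.mem_iInter₂.2 fun k hk =>
      Set.mem_iInter₂.1 hy.2 k (le_trans hk hij)⟩)
    (fun n => ⟨z n, hzS n, Set.mem_iInter₂.2 fun i hi => hzx n i hi⟩)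
    (fun n => hconv.inter fun a ha b hb ξ h0 h1 => Set.mem_iInter₂.2 fun i hi =>
      hρ.isL0Convex_le _ a (Set.mem_iInter₂.1 ha i hi) b (Set.mem_iInter₂.1 hb i hi) ξ h0 h1)
    (fun n => hclosed.inter fun y a hy hya => Set.mem_iInter₂.2 fun i hi =>
      hρ.isCondSeqClosed_le (zero_lt_one.trans hp) _ y a
        (fun k => Set.mem_iInter₂.1 (hy k) i hi) hya)
    (fun y hy => hbdd y hy.1)
  have hx₀K : s ≤ K x₀ := le_of_tendsto' hvlim fun n => by
    rw [← hxv n]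
    exact hKanti _ _ (Set.mem_iInter₂.1 (hx₀ n).2 n (le_refl n))
  refine ⟨x₀, (hx₀ 0).1, fun y hy => ?_⟩
  -- The competitor `a` lies below both `x₀` and `y`. Then `φ (ρ x₀) ≤ φ (ρ a)` a.s. while `K a ≤ s
  -- ≤ K x₀`, so the two agree a.s., and injectivity of `φ` gives `ρ x₀ = ρ a ≤ ρ y`.
  obtain ⟨a, haS, ha0, hay⟩ := hρ.exists_le_le hconv (hx₀ 0).1 hy
  refine le_trans ?_ hay
  have hle : (fun ω => φ ((ρ x₀).1 ω)) ≤ᵐ[P] fun ω => φ ((ρ a).1 ω) :=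
    (AEEqFun.coeFn_le.2 ha0).mono fun ω h => hφanti h
  have heq := ae_eq_of_ae_le_of_lintegral_le hle ((hK1 x₀).trans_lt ENNReal.one_lt_top).ne
    (hφm.comp (ρ a).1.measurable).aemeasurable
    ((le_sSup (Set.mem_image_of_mem K haS)).trans hx₀K)
  exact AEEqFun.coeFn_le.1 (heq.mono fun ω h => (hφinj h).le)

end IsCondConvexRiskMeasure

theorem isL0Convex_feasibleSet [IsProbabilityMeasure P] (hm : m ≤ mΩ) (hp : 1 ≤ p)
    (M : Submodule (L0 m P) (condLp m P p)) (π : M →ₗ[L0 m P] L0 m P) (w : L0 m P)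
    {r : L0 m P} (hr : IsPos r) :
    IsL0Convex (Subtype.val '' feasibleSet hm M π w r) := by
  rintro _ ⟨x, ⟨hx1, hx2, hx3⟩, rfl⟩ _ ⟨y, ⟨hy1, hy2, hy3⟩, rfl⟩ ξ h0 h1
  have hp0 : 0 < p := zero_lt_one.trans_le hp
  refine ⟨ξ • x + (1 - ξ) • y, ⟨?_, ?_, ?_⟩, rfl⟩
  · rw [map_add, map_smul, map_smul, hx1, hy1, ← add_smul, add_sub_cancel, one_smul]
  · refine Subtype.ext (AEEqFun.ext ?_)
    filter_upwards [condE_convexComb hm hp (x : condLp m P p) y h0 h1] with ω e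
    refine e.trans ?_
    rw [hx2, hy2]
    ring
  · rw [condNorm_le_iff hm hp0 _ hr] at hx3 hy3 ⊢
    have hc := condPow_convexComb_le hm hp (x : condLp m P p) y h0 h1
    rw [← AEEqFun.coeFn_le] at h0 h1
    filter_upwards [hc, hx3, hy3, h0, h1, AEEqFun.coeFn_zero (α := Ω) (μ := P) (β := ℝ),
      AEEqFun.coeFn_one (α := Ω) (μ := P) (β := ℝ)] with ω e1 e2 e3 e4 e5 e6 e7
    rw [e6] at e4
    rw [e7, Pi.one_apply] at e5
    refine e1.trans ((add_le_add (mul_le_mul_right e2 _) (mul_le_mul_right e3 _)).trans_eq ?_)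
    rw [← add_mul, ← ENNReal.ofReal_add e4 (sub_nonneg.2 e5), add_sub_cancel, ENNReal.ofReal_one,
      one_mul]

theorem isCondSeqClosed_feasibleSet [IsProbabilityMeasure P] (hm : m ≤ mΩ) (hp : 1 ≤ p)
    {M : Submodule (L0 m P) (condLp m P p)}
    (hM : IsClosed[epsTopology (condNorm (p := p) hm)] (M : Set (condLp m P p)))
    {π : M →ₗ[L0 m P] L0 m P}
    (hπ : Continuous[TopologicalSpace.induced Subtype.val (epsTopology (condNorm (p := p) hm)),
      epsTopology absL0] π) (w : L0 m P) {r : L0 m P} (hr : IsPos r) :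
    IsCondSeqClosed (Subtype.val '' feasibleSet hm M π w r) := by
  intro y x hy hyx
  have hp0 : 0 < p := zero_lt_one.trans_le hp
  choose y' hy' hyy' using hy
  have hxM : x ∈ M := isCondSeqClosed_of_isClosed_epsTopology hm hp0 hM y x
    (fun k => hyy' k ▸ (y' k).2) hyx
  refine ⟨⟨x, hxM⟩, ⟨?_, ?_, ?_⟩, rfl⟩
  · by_contra hne
    -- If `π x ≠ 1`, then `x` lies in an open `U` whose trace on `M` is `{π ≠ 1}`. The sequence must
    -- enter `U`, although `π = 1` along it.
    obtain ⟨U, hU, hUπ⟩ := @Continuous.isOpen_preimage _ _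
      (TopologicalSpace.induced Subtype.val (epsTopology (condNorm (p := p) hm)))
      (epsTopology absL0) _ hπ _ (isOpen_compl_singleton_epsTopology_absL0 (1 : L0 m P))
    have hxU : x ∈ U := by
      have : (⟨x, hxM⟩ : M) ∈ Subtype.val ⁻¹' U := by
        rw [hUπ]
        exact hne
      exact this
    obtain ⟨k, hk⟩ := hyx.exists_mem_of_isOpen hm hp0 hU hxU
    have hk' : y' k ∈ Subtype.val ⁻¹' U := by
      change (y' k : condLp m P p) ∈ U
      rw [hyy' k]
      exact hk
    rw [hUπ] at hk'
    exact hk' (hy' k).1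
  · exact isCondSeqClosed_condE_eq hm hp w y x (fun k => hyy' k ▸ (hy' k).2.1) hyx
  · rw [condNorm_le_iff hm hp0 _ hr]
    refine isCondSeqClosed_condPow_le hp (Eventually.of_forall fun ω =>
      ENNReal.rpow_lt_top_of_nonneg p.coe_nonneg ENNReal.ofReal_ne_top) y x (fun k => ?_) hyx
    have := (hy' k).2.2
    rw [condNorm_le_iff hm hp0 _ hr, hyy' k] at this
    exact this

end Minimization

end CondRisk

end

open CondRisk in
theorem theorem4p11 {Ω : Type*} (m mΩ : MeasurableSpace Ω) (hm : m ≤ mΩ)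
    (P : Measure Ω) [IsProbabilityMeasure P] (p : ℝ≥0) (hp : 1 < p)
    (M : Submodule (L0 m P) (condLp m P p))
    (hM : IsClosed[epsTopology (condNorm (p := p) hm)] (M : Set (condLp m P p)))
    (π : M →ₗ[L0 m P] L0 m P)
    (hπ : Continuous[TopologicalSpace.induced Subtype.val (epsTopology (condNorm (p := p) hm)),
      epsTopology absL0] π)
    (w r : L0 m P) (hr : IsPos r)
    (hG : (feasibleSet hm M π w r).Nonempty)
    (ρ : condLp m P p → L0bar m P) (hρ : IsCondConvexRiskMeasure hm ρ) :
    ∃ x₀ ∈ feasibleSet hm M π w r, ∀ x ∈ feasibleSet hm M π w r, ρ x₀ ≤ ρ x := by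
  obtain ⟨_, ⟨x₀, hx₀, rfl⟩, hmin⟩ := hρ.exists_isMinOn hp (hG.image Subtype.val)
    (isL0Convex_feasibleSet hm hp.le M π w hr) (isCondSeqClosed_feasibleSet hm hp.le hM hπ w hr) hr
    (by
      rintro _ ⟨x, hx, rfl⟩
      exact (condNorm_le_iff hm (zero_lt_one.trans hp) _ hr).1 hx.2.2)
  exact ⟨x₀, hx₀, fun x hx => hmin _ ⟨x, hx, rfl⟩⟩
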